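/- Let $\mathtt{k}$ be an algebraically closed field of characteristic zero and let $\mathfrak g=\mathfrak{gl}(m,n)$, with Cartan subalgebra $\mathfrak h$ of diagonal matrices, $\mathfrak n^{+}$ (resp. $\mathfrak n^-$) the strictly upper (resp. lower) triangular matrices, and Borel subalgebra $\mathfrak b=\mathfrak h\oplus\mathfrak n^+$. Let $\epsilon_1,\dots,\epsilon_m,\delta_1,\dots,\delta_n$ be the coordinate functionals on $\mathfrak h$, and let $(\,,)$ be the bilinear form on $\mathfrak h^*$ with $(\epsilon_i,\epsilon_j)=\delta_{ij}=-(\delta_i,\delta_j)$ and $(\epsilon_i,\delta_j)=0$. The positive even roots are $\epsilon_i-\epsilon_j$ and $\delta_i-\delta_j$ $(i<j)$; the positive odd roots, which are exactly the isotropic positive roots, are $\epsilon_r-\delta_s$. Let $\Delta^+$ be the set of positive roots and let $\rho=\rho_0-\rho_1$, where $\rho_0$ (resp. $\rho_1$) is half the sum of the even (resp. odd) positive roots. For $\alpha\in\mathfrak h^*$ let $h_\alpha\in\mathfrak h$ satisfy $\beta(h_\alpha)=(\alpha,\beta)$ for all $\beta\in\mathfrak h^*$. For $\alpha\in\Delta^+$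 let $e_{\alpha}$ be a non-zero root vector of weight $\alpha$ and let $e_{-\alpha}$ be the matrix unit of weight $-\alpha$. Fix an ordering of $\Delta^+$. A partition of a weight $\eta$ is a map $\pi:\Delta^+\to\mathbb N$ with $\pi(\alpha)\le 1$ for isotropic $\alpha$ and $\sum_\alpha\pi(\alpha)\alpha=\eta$; put $e_{-\pi}=\prod_{\alpha}e_{-\alpha}^{\pi(\alpha)}$, the product being taken in the fixed order. For an isotropic positive root $\gamma$, a Šapovalov element for $\gamma$ is an element $\theta_\gamma=\sum_\pi e_{-\pi}H_\pi$ of $U(\mathfrak g)$, the sum over the partitions $\pi$ of $\gamma$, with $H_\pi\in U(\mathfrak h)$, with $H_{\pi^0}=1$ for the unique partition $\pi^0$ of $\gamma$ that vanishes outside the simple roots, and with $$e_\alpha\theta_\gamma\in U(\mathfrak g)\bigl(h_\gamma+\rho(h_\gamma)\bigr)+U(\mathfrak g)\mathfrak n^+\qquad\text{for all }\alpha\in\Delta^+.$$ Let $\lambda\in\mathfrak h^*$, let $M(\lambda)$ be the Verma module induced from $\mathfrak b$ with highest weight vector $v_\lambda$ of weight $\lambda$, and let $B(\lambda)$ be the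 set of isotropic positive roots $\alpha$ with $(\lambda+\rho,\alpha)=0$. For each $\gamma\in B(\lambda)$ let $\theta_\gamma$ be a Šapovalov element for $\gamma$. For $\gamma,\gamma'\in B(\lambda)$ write $\gamma'\le\gamma$ if $\gamma-\gamma'$ is a (possibly empty) sum of positive even roots, and $\gamma'\downarrow\gamma$ if $\gamma'\le\gamma$ and $(\gamma,\gamma')\neq0$. Call $\gamma\in B(\lambda)$ $\lambda$-minimal if $\gamma'\downarrow\gamma$ with $\gamma'\in B(\lambda)$ implies $\gamma'=\gamma$, and independent at $\lambda$ if $$\theta_\gamma v_\lambda\notin\sum_{\gamma'\in B(\lambda),\ \gamma'\ne\gamma}U(\mathfrak g)\,\theta_{\gamma'}v_\lambda .$$ Then $\gamma\in B(\lambda)$ is independent at $\lambda$ if and only if $\gamma$ is $\lambda$-minimal. -/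

import Mathlib

/-! The general linear Lie superalgebra `gl(m,n)` over a field `K`, with its distinguished Borel
subalgebra (upper triangular matrices).  The index set is `Fin (m + n)`: the first `m` indices are
even, the last `n` indices are odd. -/

noncomputable section

namespace GLSuper

variable (K : Type*) [Field K] (m n : ℕ)

/-- The parity of an index: `0` for the first `m` indices, `1` for the last `n`. -/
def parity (i : Fin (m + n)) : ZMod 2 := if i.val < m then 0 else 1

/-- The underlying vector space of `gl(m,n)`. -/
abbrev gl := Matrix (Fin (m + n)) (Fin (m + n)) K

/-- The matrix `x` is homogeneous of degree `p`: `p = 0` means block diagonal,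
`p = 1` means block off-diagonal. -/
def IsHomogeneous (p : ZMod 2) (x : gl K m n) : Prop :=
  ∀ i j, x i j ≠ 0 → parity m n i + parity m n j = p

/-- The sign `(-1) ^ (p q)`. -/
def superSign (p q : ZMod 2) : K := if p = 1 ∧ q = 1 then -1 else 1

/-- The defining relations of the enveloping algebra of `gl(m,n)`:
`x y - (-1)^(p q) y x = [x, y]` for homogeneous matrices `x`, `y` of degrees `p`, `q`, where
`[x, y]` is the supercommutator of matrices. -/
inductive EnvelopingRel : TensorAlgebra K (gl K m n) → TensorAlgebra K (gl K m n) → Prop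
  | superbracket (p q : ZMod 2) (x y : gl K m n)
      (hx : IsHomogeneous K m n p x) (hy : IsHomogeneous K m n q y) :
      EnvelopingRel
        (TensorAlgebra.ι K x * TensorAlgebra.ι K y
          - superSign K p q • (TensorAlgebra.ι K y * TensorAlgebra.ι K x))
        (TensorAlgebra.ι K (x * y - superSign K p q • (y * x)))

/-- The universal enveloping algebra `U(gl(m,n))`. -/
abbrev U := RingQuot (EnvelopingRel K m n)

/-- The canonical map `gl(m,n) → U(gl(m,n))`. -/
def toU : gl K m n →ₗ[K] U K m n :=
  (RingQuot.mkAlgHom K (EnvelopingRel K m n)).toLinearMap ∘ₗ TensorAlgebra.ι K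

/-- The dual `𝔥*` of the space `𝔥` of diagonal matrices; the weight `l` is the functional
`diag(a) ↦ ∑ i, l i * a i`, so that the coordinate functionals are
`ε_1, …, ε_m, δ_1, …, δ_n`. -/
abbrev Weight := Fin (m + n) → K

/-- The bilinear form on `𝔥*` induced by the supertrace form:
`(ε_i, ε_j) = δ_ij`, `(δ_i, δ_j) = -δ_ij`, `(ε_i, δ_j) = 0`. -/
def form (a b : Weight K m n) : K :=
  ∑ i, (if parity m n i = 0 then 1 else -1) * (a i * b i)

/-- The element `h_a` of `𝔥`, in `U(gl(m,n))`, with `b(h_a) = (a, b)` for all weights `b`. -/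
def hElt (a : Weight K m n) : U K m n :=
  toU K m n (Matrix.diagonal fun i => (if parity m n i = 0 then 1 else -1) * a i)

/-- The positive roots; the pair `(i, j)` with `i < j` stands for the root whose root space
is spanned by the matrix unit `e_{i,j}`. -/
abbrev PosRoot := {p : Fin (m + n) × Fin (m + n) // p.1 < p.2}

variable {m n}

namespace PosRoot

/-- The root as an element of `𝔥*`. -/
def weight (a : PosRoot m n) : Weight K m n := Pi.single a.1.1 1 - Pi.single a.1.2 1

/-- Odd roots, that is, the roots `ε_r - δ_s`. -/
def IsOdd (a : PosRoot m n) : Prop := parity m n a.1.1 ≠ parity m n a.1.2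

/-- Simple roots. -/
def IsSimple (a : PosRoot m n) : Prop := a.1.2.val = a.1.1.val + 1

/-- The root vector `e_{-a}` in `U(gl(m,n))`: the matrix unit `e_{j,i}` if `a` is given
by `(i, j)`. -/
def lowering (a : PosRoot m n) : U K m n := toU K m n (Matrix.single a.1.2 a.1.1 1)

/-- The root vector spanning the root space of `a` (up to a non-zero scalar, `e_a`). -/
def raising (a : PosRoot m n) : U K m n := toU K m n (Matrix.single a.1.1 a.1.2 1)

/-- A positive root of `gl(m,n)` is isotropic exactly if it is odd. -/
theorem form_weight_self_eq_zero_iff [CharZero K] (a : PosRoot m n) :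
    form K m n (a.weight K) (a.weight K) = 0 ↔ a.IsOdd := by
  obtain ⟨⟨i, j⟩, hij⟩ := a
  have hne : i ≠ j := ne_of_lt hij
  have h : form K m n (weight K ⟨(i, j), hij⟩) (weight K ⟨(i, j), hij⟩)
      = (if parity m n i = 0 then 1 else -1) + (if parity m n j = 0 then 1 else -1) := by
    unfold form weight
    rw [← Finset.sum_subset (Finset.subset_univ {i, j}), Finset.sum_pair hne]
    · simp [hne, hne.symm]
    · intro k _ hk
      simp only [Finset.mem_insert, Finset.mem_singleton, not_or] at hk
      simp [hk.1, hk.2]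
  have h2 : (1 : K) + 1 ≠ 0 := by norm_num
  have h3 : (-1 : K) + -1 ≠ 0 := by norm_num
  have h01 : (0 : ZMod 2) ≠ 1 := by decide
  rw [h]
  unfold IsOdd parity
  split_ifs <;> simp_all

end PosRoot

/-- `ρ = ρ_0 - ρ_1`, where `ρ_0` (resp. `ρ_1`) is half the sum of the even (resp. odd) positive
roots. -/
def rho : Weight K m n := by
  classical
  exact (2⁻¹ : K) • (∑ a : PosRoot m n with ¬ a.IsOdd, a.weight K)
    - (2⁻¹ : K) • (∑ a : PosRoot m n with a.IsOdd, a.weight K)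

/-- `π` is a partition of the weight `η`: a map from the positive roots to `ℕ`, at most `1` on
isotropic roots, with `∑ π(a) a = η`.  (No even root of `gl(m,n)` is twice a root.) -/
def IsPartition (η : Weight K m n) (π : PosRoot m n → ℕ) : Prop :=
  (∀ a, a.IsOdd → π a ≤ 1) ∧ ∑ a, π a • a.weight K = η

/-- The list `L` is an ordering of the set of all positive roots. -/
def IsOrdering (L : List (PosRoot m n)) : Prop := L.Nodup ∧ ∀ a, a ∈ L

/-- The monomial `e_{-π} = ∏ e_{-a}^{π(a)}`, the product taken in the order of `L`. -/
def monomial (L : List (PosRoot m n)) (π : PosRoot m n → ℕ) : U K m n :=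
  (L.map fun a => a.lowering K ^ π a).prod

variable (m n)

/-- The subalgebra `U(𝔥)` of `U(gl(m,n))`. -/
def Uh : Subalgebra K (U K m n) :=
  Algebra.adjoin K (Set.range fun a : Fin (m + n) → K => toU K m n (Matrix.diagonal a))

/-- The subspace `𝔫⁺` of strictly upper triangular matrices, in `U(gl(m,n))`. -/
def nPlus : Set (U K m n) :=
  toU K m n '' {x : gl K m n | ∀ i j, j ≤ i → x i j = 0}

variable {m n}

/-- `θ` is a Šapovalov element for the isotropic positive root `c` (with multiplicity one).
It has the form `θ = ∑ e_{-π} H_π`, the sum over the partitions `π` of `c`, with `H_π` in `U(𝔥)`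
(`H` is a finitely supported family); the coefficient of `e_{-π₀}` is `1`, where `π₀` is the (unique)
partition of `c` that is zero outside the simple roots; and, for all positive roots `a`,
`e_a θ` lies in `U(𝔤) (h_c + ρ(h_c)) + U(𝔤) 𝔫⁺`
(the summand `- (c, c) / 2` is zero, since `c` is isotropic). -/
def IsSapovalov (L : List (PosRoot m n)) (c : PosRoot m n) (θ : U K m n) : Prop :=
  (∃ H : (PosRoot m n → ℕ) →₀ U K m n,
    (∀ π, H π ≠ 0 → IsPartition K (c.weight K) π) ∧
    (∀ π, H π ∈ Uh K m n) ∧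
    (∃ π₀, IsPartition K (c.weight K) π₀ ∧ (∀ a, ¬ a.IsSimple → π₀ a = 0) ∧ H π₀ = 1) ∧
    θ = H.sum fun π h => monomial K L π * h) ∧
  ∀ a : PosRoot m n, a.raising K * θ ∈
    (Submodule.span (U K m n)
        {hElt K m n (c.weight K)
          + algebraMap K (U K m n) (form K m n (rho K) (c.weight K))} ⊔
      Submodule.span (U K m n) (nPlus K m n) : Submodule (U K m n) (U K m n))

/-- The left ideal of `U(gl(m,n))` generated by `𝔫⁺` and by all `h - l(h)` with `h` in `𝔥`. -/
def vermaIdeal (l : Weight K m n) : Submodule (U K m n) (U K m n) :=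
  Submodule.span (U K m n) (nPlus K m n ∪
    Set.range fun a : Fin (m + n) → K =>
      toU K m n (Matrix.diagonal a) - algebraMap K (U K m n) (∑ i, l i * a i))

/-- The Verma module `M(l)`, induced from the one-dimensional module of weight `l` of the Borel
subalgebra. -/
abbrev Verma (l : Weight K m n) := U K m n ⧸ vermaIdeal K l

/-- The highest weight vector `v_l` of `M(l)`. -/
def vermaVec (l : Weight K m n) : Verma K l := (vermaIdeal K l).mkQ 1

/-- The set `B(l)` of the isotropic positive roots `a` with `(l + ρ, a) = 0`. -/
def B (l : Weight K m n) : Set (PosRoot m n) :=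
  {a | a.IsOdd ∧ form K m n (l + rho K) (a.weight K) = 0}

/-- The Bruhat-type order: `c' ≤ c` if `c - c'` is a (possibly empty) sum of positive even
roots. -/
def BruhatLE (c' c : PosRoot m n) : Prop :=
  c.weight K - c'.weight K ∈
    AddSubmonoid.closure {w : Weight K m n | ∃ a : PosRoot m n, ¬ a.IsOdd ∧ a.weight K = w}

/-- The relation `c' ↓ c`. -/
def Down (c' c : PosRoot m n) : Prop :=
  BruhatLE K c' c ∧ form K m n (c.weight K) (c'.weight K) ≠ 0

/-- `c` is `l`-minimal. -/
def IsMinimalAt (l : Weight K m n) (c : PosRoot m n) : Prop :=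
  ∀ c' ∈ B K l, Down K c' c → c' = c

/-- `c` is independent at `l`, for the family `θ` of Šapovalov elements: `θ_c v_l` does not lie in
`∑ U(𝔤) θ_{c'} v_l`, the sum over the roots `c' ≠ c` in `B(l)`. -/
def IsIndependentAt (θ : PosRoot m n → U K m n) (l : Weight K m n) (c : PosRoot m n) : Prop :=
  θ c • vermaVec K l ∉
    ⨆ c' ∈ B K l \ {c}, Submodule.span (U K m n) {θ c' • vermaVec K l}

end GLSuper

end

/-!
Write `x` for the coordinates of `l + ρ` and a root as the pair `(a, b)`, `a < b`, of its indices.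
In terms of `x`, the odd root `(a, b)` belongs to `B l` if and only if `x_a + x_b = 0`
(`mem_B_iff`), and `c' ↓ c` means that the interval of `c'` arises from the one of `c` by moving
exactly one of its two ends inwards (`down_iff`).

*Šapovalov elements on the highest weight vector.* The monomials of the partitions of `(a, b)` are
the products, in some order, of the lowering operators `e_{j,i}` along a chain `a < i₁ < ⋯ < b`.
Reordering a product only creates shorter chains, so `θ_c v` is a combination of the products
`e_{i₁,a} e_{i₂,i₁} ⋯ e_{b,i_k}` in which the full chain `a < a + 1 < ⋯ < b` has coefficient `1`
(`IsSapovalov.exists_isChainSum`).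
As `θ_c v` is singular, the remaining coefficients are determined, and `θ_c v` is the nested
`q`-commutator `Θ_c v` of the simple lowering operators `f_p`, built by
`Θ ↦ (1 - c_{p+1}) f_p Θ + c_{p+1} Θ f_p`, where `c_j = x_a - x_j` for even indices `j` and
`c_j = 1 - x_a - x_j` for odd ones (`IsSapovalov.sub_mem`).
Reading off coefficients needs the linear independence of the chain products on `v`. In place of
a Poincaré–Birkhoff–Witt theorem, this uses an oscillator representation (`fockRep`): `e_{i,j}` acts
by `∑ k, a⁺_{i,k} a⁻_{j,k}`, for bosonic or fermionic oscillators `a^±_{i,k}`, one copy of the natural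
module for each index `k`. Their vacuum can be given any highest weight `l`, so that the Verma
module maps to the Fock space, and the operators `e_{q,k}` act independently of each other on
vectors in which the `k`-th copy is not yet excited (`eq_zero_of_sum_lowering`).

*A root which is not minimal is not independent.* If `(a, b)` and `(j, b)` are in `B l`, then
`c_j = 0`, and `Θ_{(a,b)}` is a left multiple of `Θ_{(j,b)}`. If `(a, b)` and `(a, j)` are in `B l`,
then `c_j = 1`, and `Θ_{(a,b)}` is a left multiple of `Θ_{(a,j)}` (`exists_sapovalovElt_eq_mul`).

*A minimal root is independent.* If `θ_c v` is in the sum of the submodules generated by the other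
`θ_{c'} v`, then in the Fock space its image is a combination of vectors `e_{-α₁} ⋯ e_{-α_k} θ_{c'} v`
of the same weight, so that `c'` and the `α_i` form a chain for `c`. In particular the interval of
`c'` lies inside the one of `c`, and the `α_i` are even. The quadratic Casimir element of the
subalgebra `gl(m)` commutes with the even part of `gl(m,n)`, so these vectors are eigenvectors of
it, and its eigenvalue exceeds the one on `θ_c v` by `2 (x_a - x_{a'})`, where `a` and `a'` are the
left ends of `c` and `c'`. The minimality of `c` says that this is not `0` (`IsMinimalAt.ne`).
Eigenvectors for different eigenvalues being independent, `θ_c v` is `0` in the Fock space, which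
contradicts the coefficient `1` of the full chain.
-/

namespace GLSuper

noncomputable section

/-! ### Matrix units in the enveloping algebra -/

section MatrixUnits

variable (K : Type*) [Field K] (m n : ℕ)

/-- The matrix unit `e_{i,j}` in `U(gl(m,n))`, with indices counted from `0`; it is `0` by
convention when an index is out of range. -/
def matUnit (i j : ℕ) : U K m n :=
  if h : i < m + n ∧ j < m + n then toU K m n (Matrix.single ⟨i, h.1⟩ ⟨j, h.2⟩ 1) else 0

/-- The sign `(-1) ^ (p q)`, for `p` and `q` the parities of `e_{i,j}` and `e_{k,l}`. -/
def unitSign (i j k l : ℕ) : K :=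
  if ¬ (i < m ↔ j < m) ∧ ¬ (k < m ↔ l < m) then -1 else 1

variable {K m n}

theorem matUnit_fin (i j : Fin (m + n)) :
    matUnit K m n i j = toU K m n (Matrix.single i j 1) := by
  simp [matUnit]

theorem raising_eq (a : PosRoot m n) : a.raising K = matUnit K m n a.1.1 a.1.2 := by
  rw [matUnit_fin]; rfl

theorem lowering_eq (a : PosRoot m n) : a.lowering K = matUnit K m n a.1.2 a.1.1 := by
  rw [matUnit_fin]; rfl

theorem toU_mul_toU (p q : ZMod 2) (x y : gl K m n)
    (hx : IsHomogeneous K m n p x) (hy : IsHomogeneous K m n q y) :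
    toU K m n x * toU K m n y - superSign K p q • (toU K m n y * toU K m n x)
      = toU K m n (x * y - superSign K p q • (y * x)) := by
  have h := RingQuot.mkAlgHom_rel K (EnvelopingRel.superbracket p q x y hx hy)
  simpa [toU, LinearMap.comp_apply] using h

theorem isHomogeneous_single (i j : Fin (m + n)) :
    IsHomogeneous K m n (parity m n i + parity m n j) (Matrix.single i j 1) := by
  intro a b hab
  by_cases h : i = a ∧ j = b
  · rw [h.1, h.2]
  · exact absurd (by simp [h]) hab

theorem parity_add_eq_one_iff (i j : Fin (m + n)) :
    parity m n i + parity m n j = 1 ↔ ¬ (i.1 < m ↔ j.1 < m) := by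
  have h11 : (1 : ZMod 2) + 1 ≠ 1 := by decide
  unfold parity
  by_cases hi : i.1 < m <;> by_cases hj : j.1 < m <;> simp [hi, hj]

theorem superSign_parity (i j k l : Fin (m + n)) :
    superSign K (parity m n i + parity m n j) (parity m n k + parity m n l)
      = unitSign K m i j k l := by
  unfold superSign unitSign
  simp only [parity_add_eq_one_iff]

/-- The defining relations of `U(gl(m,n))`, for matrix units. -/
theorem matUnit_mul {i j k l : ℕ} (hi : i < m + n) (hj : j < m + n) (hk : k < m + n)
    (hl : l < m + n) :
    matUnit K m n i j * matUnit K m n k l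
      = unitSign K m i j k l • (matUnit K m n k l * matUnit K m n i j)
        + (if j = k then matUnit K m n i l else 0)
        - unitSign K m i j k l • (if i = l then matUnit K m n k j else 0) := by
  have h := toU_mul_toU (K := K) _ _ _ _ (isHomogeneous_single ⟨i, hi⟩ ⟨j, hj⟩)
    (isHomogeneous_single ⟨k, hk⟩ ⟨l, hl⟩)
  rw [superSign_parity, map_sub, map_smul] at h
  simp only [← matUnit_fin] at h
  have key : ∀ a b c d : Fin (m + n), toU K m n (Matrix.single a b (1 : K) * Matrix.single c d 1)
      = if (b : ℕ) = c then matUnit K m n a d else 0 := by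
    intro a b c d
    by_cases hbc : b = c
    · subst hbc; simp [matUnit_fin]
    · rw [Matrix.single_mul_single_of_ne _ _ _ _ hbc, map_zero,
        if_neg (fun h => hbc (Fin.ext h))]
  rw [key, key, sub_eq_iff_eq_add] at h
  simp only [eq_comm (a := l)] at h
  rw [h]
  abel

theorem unitSign_eq_one {i j k l : ℕ} (h : (i < m ↔ j < m) ∨ (k < m ↔ l < m)) :
    unitSign K m i j k l = 1 := by
  unfold unitSign; rw [if_neg]; tauto

theorem toU_eq_sum (x : gl K m n) :
    toU K m n x = ∑ i, ∑ j, x i j • matUnit K m n i j := by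
  conv_lhs => rw [Matrix.matrix_eq_sum_single x]
  simp only [map_sum]
  refine Finset.sum_congr rfl fun i _ => Finset.sum_congr rfl fun j _ => ?_
  rw [matUnit_fin, ← map_smul, Matrix.smul_single, smul_eq_mul, mul_one]

theorem toU_diagonal (a : Fin (m + n) → K) :
    toU K m n (Matrix.diagonal a) = ∑ i, a i • matUnit K m n i i := by
  rw [toU_eq_sum]
  refine Finset.sum_congr rfl fun i _ => ?_
  rw [Finset.sum_eq_single i]
  · simp
  · intro j _ hj; simp [Matrix.diagonal_apply_ne' a hj]
  · simp

/-- The enveloping algebra is generated by the matrix units. -/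
theorem U_induction {P : U K m n → Prop} (hc : ∀ r, P (algebraMap K _ r))
    (he : ∀ i j : Fin (m + n), P (matUnit K m n i j)) (hadd : ∀ x y, P x → P y → P (x + y))
    (hmul : ∀ x y, P x → P y → P (x * y)) (u : U K m n) : P u := by
  obtain ⟨t, rfl⟩ := RingQuot.mkAlgHom_surjective K (EnvelopingRel K m n) u
  have hsum : ∀ (ι : Type) (s : Finset ι) (f : ι → U K m n), (∀ i, P (f i)) →
      P (∑ i ∈ s, f i) := fun ι s f hf =>
    Finset.sum_induction f P hadd (by simpa using hc 0) fun i _ => hf i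
  induction t using TensorAlgebra.induction with
  | algebraMap r => simpa using hc r
  | ι x =>
    have := toU_eq_sum (K := K) (m := m) (n := n) x
    change P (toU K m n x)
    rw [this]
    refine hsum _ _ _ fun i => hsum _ _ _ fun j => ?_
    rw [Algebra.smul_def]
    exact hmul _ _ (hc _) (he i j)
  | mul a b ha hb => rw [map_mul]; exact hmul _ _ ha hb
  | add a b ha hb => rw [map_add]; exact hadd _ _ ha hb

end MatrixUnits

/-! ### The weight `ρ` and the form -/

section Rho

variable {K : Type*} [Field K] {m n : ℕ}

theorem isOdd_iff (a : PosRoot m n) : a.IsOdd ↔ a.1.1.1 < m ∧ m ≤ a.1.2.1 := by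
  have h : a.1.1.1 < a.1.2.1 := a.2
  have h01 : (0 : ZMod 2) ≠ 1 := by decide
  unfold PosRoot.IsOdd parity
  by_cases h1 : a.1.1.1 < m <;> by_cases h2 : a.1.2.1 < m <;> simp [h1, h2] <;> omega

/-- Up to the factor `2⁻¹`, each root `(i, j)` contributes `± 1` to the coordinates `i` and `j` of
`ρ`, with signs according to its parity. -/
theorem rho_apply (i : Fin (m + n)) :
    (rho K : Weight K m n) i = 2⁻¹ * ∑ j : Fin (m + n),
      (if i < j then (if (i.1 < m ↔ j.1 < m) then 1 else -1)
        else if j < i then (if (i.1 < m ↔ j.1 < m) then -1 else 1) else 0) := by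
  classical
  have h0 : (rho K : Weight K m n) i = 2⁻¹ * ∑ a : PosRoot m n,
      (if (a.1.1.1 < m ↔ a.1.2.1 < m) then (1 : K) else -1)
        * (Pi.single (M := fun _ => K) a.1.1 1 i - Pi.single (M := fun _ => K) a.1.2 1 i) := by
    have hsplit : ∀ f : PosRoot m n → K, ∑ a : PosRoot m n,
        (if (a.1.1.1 < m ↔ a.1.2.1 < m) then (1 : K) else -1) * f a
        = ∑ a : PosRoot m n with ¬ a.IsOdd, f a - ∑ a : PosRoot m n with a.IsOdd, f a := by
      intro f
      rw [Finset.sum_filter, Finset.sum_filter, ← Finset.sum_sub_distrib]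
      refine Finset.sum_congr rfl fun a _ => ?_
      have hlt : a.1.1.1 < a.1.2.1 := a.2
      by_cases ho : a.IsOdd
      · have := (isOdd_iff a).1 ho
        rw [if_neg (by omega)]; simp [ho]
      · have : ¬ (a.1.1.1 < m ∧ m ≤ a.1.2.1) := fun h => ho ((isOdd_iff a).2 h)
        rw [if_pos (by omega)]; simp [ho]
    rw [hsplit, mul_sub]
    unfold rho
    simp only [Pi.sub_apply, Pi.smul_apply, Finset.sum_apply, smul_eq_mul, PosRoot.weight]
  rw [h0]
  congr 1
  set s : Fin (m + n) → Fin (m + n) → K :=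
    fun i j => if (i.1 < m ↔ j.1 < m) then (1 : K) else -1 with hs
  have h1 := Finset.sum_subtype (Finset.univ.filter fun p : Fin (m + n) × Fin (m + n) => p.1 < p.2)
    (p := fun p => p.1 < p.2) (F := (inferInstance : Fintype (PosRoot m n))) (by simp)
    (fun p => s p.1 p.2
      * (Pi.single (M := fun _ => K) p.1 1 i - Pi.single (M := fun _ => K) p.2 1 i))
  rw [← h1, Finset.sum_filter, Fintype.sum_prod_type]
  simp only [Pi.single_apply, mul_sub, mul_ite, mul_one, mul_zero]
  have h2 : ∀ a b : Fin (m + n), (if a < b then ((if i = a then s a b else 0)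
      - (if i = b then s a b else 0)) else 0)
      = (if i = a then (if a < b then s a b else 0) else 0)
        - (if i = b then (if a < b then s a b else 0) else 0) := by
    intro a b; split_ifs <;> simp
  simp only [h2, Finset.sum_sub_distrib, Finset.sum_ite_eq, Finset.mem_univ, if_true]
  rw [Finset.sum_comm]
  simp only [Finset.sum_ite_eq, Finset.mem_univ, if_true]
  rw [← Finset.sum_sub_distrib]
  refine Finset.sum_congr rfl fun j _ => ?_
  simp only [hs]
  rcases lt_trichotomy i j with h | h | h
  · simp [h, h.not_gt]
  · subst h; simp
  · rw [if_neg h.not_gt, if_pos h, if_neg h.not_gt, if_pos h]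
    by_cases h1 : i.1 < m <;> by_cases h2 : j.1 < m <;> simp [h1, h2]

theorem rho_sub_of_parity_eq [CharZero K] {i j : Fin (m + n)} (hij : j.1 = i.1 + 1)
    (h : i.1 < m ↔ j.1 < m) : (rho K : Weight K m n) i - (rho K : Weight K m n) j = 1 := by
  have hne : j ≠ i := by rintro rfl; omega
  rw [rho_apply, rho_apply, ← mul_sub, ← Finset.sum_sub_distrib]
  have : ∀ k : Fin (m + n), ((if i < k then (if (i.1 < m ↔ k.1 < m) then (1 : K) else -1)
        else if k < i then (if (i.1 < m ↔ k.1 < m) then -1 else 1) else 0)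
      - (if j < k then (if (j.1 < m ↔ k.1 < m) then 1 else -1)
        else if k < j then (if (j.1 < m ↔ k.1 < m) then -1 else 1) else 0))
      = (if k = i then 1 else 0) + (if k = j then 1 else 0) := by
    intro k
    by_cases hki : k = i
    · subst hki
      have h1 : k < j := by rw [Fin.lt_def]; omega
      simp [h1.not_gt, h1, hne.symm, h]
    by_cases hkj : k = j
    · subst hkj
      have h1 : i < k := by rw [Fin.lt_def]; omega
      simp [h1, hne, h]
    have h3 : i < k ↔ j < k := by
      rw [Fin.lt_def, Fin.lt_def]; have := fun h => hkj (Fin.ext h); omega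
    have h4 : k < i ↔ k < j := by
      rw [Fin.lt_def, Fin.lt_def]; have := fun h => hki (Fin.ext h); omega
    simp [h3, h4, h, hki, hkj]
  rw [Finset.sum_congr rfl fun k _ => this k, Finset.sum_add_distrib]
  simp only [Finset.sum_ite_eq', Finset.mem_univ, if_true]
  norm_num

theorem rho_add_of_parity_ne {i j : Fin (m + n)} (hij : j.1 = i.1 + 1)
    (h : ¬ (i.1 < m ↔ j.1 < m)) : (rho K : Weight K m n) i + (rho K : Weight K m n) j = 0 := by
  have hne : j ≠ i := by rintro rfl; omega
  rw [rho_apply, rho_apply, ← mul_add, ← Finset.sum_add_distrib]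
  have : ∀ k : Fin (m + n), ((if i < k then (if (i.1 < m ↔ k.1 < m) then (1 : K) else -1)
        else if k < i then (if (i.1 < m ↔ k.1 < m) then -1 else 1) else 0)
      + (if j < k then (if (j.1 < m ↔ k.1 < m) then 1 else -1)
        else if k < j then (if (j.1 < m ↔ k.1 < m) then -1 else 1) else 0))
      = (if k = i then 1 else 0) - (if k = j then 1 else 0) := by
    intro k
    by_cases hki : k = i
    · subst hki
      have h1 : k < j := by rw [Fin.lt_def]; omega
      have h2 : ¬ (j.1 < m ↔ k.1 < m) := fun h' => h h'.symm
      simp only [lt_self_iff_false, h1.not_gt, h1, hne.symm, h2, if_true, if_false]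
      simp
    by_cases hkj : k = j
    · subst hkj
      have h1 : i < k := by rw [Fin.lt_def]; omega
      simp only [lt_self_iff_false, h1, hne, h, if_true, if_false]
      simp
    have h3 : i < k ↔ j < k := by
      rw [Fin.lt_def, Fin.lt_def]; have := fun h => hkj (Fin.ext h); omega
    have h4 : k < i ↔ k < j := by
      rw [Fin.lt_def, Fin.lt_def]; have := fun h => hki (Fin.ext h); omega
    have h5 : (i.1 < m ↔ k.1 < m) ↔ ¬ (j.1 < m ↔ k.1 < m) := by tauto
    simp only [h3, h4, hki, hkj, if_false, h5]
    by_cases h6 : (j.1 < m ↔ k.1 < m) <;> simp only [h6, not_true, not_false_iff, if_true, if_false]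
      <;> split_ifs <;> simp
  rw [Finset.sum_congr rfl fun k _ => this k, Finset.sum_sub_distrib]
  simp

theorem form_weight (a : Weight K m n) (c : PosRoot m n) :
    form K m n a (c.weight K) = (if c.1.1.1 < m then 1 else -1) * a c.1.1
      - (if c.1.2.1 < m then 1 else -1) * a c.1.2 := by
  have hp : ∀ i : Fin (m + n), parity m n i = 0 ↔ i.1 < m := by
    intro i; unfold parity; split_ifs with h <;> simp [h]
  unfold form PosRoot.weight
  simp only [Pi.sub_apply, mul_sub, Finset.sum_sub_distrib, Pi.single_apply, hp]
  simp

/-- In the odd coordinates the form is negative, so that the condition `(l + ρ, c) = 0` becomes the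
vanishing of a sum of two coordinates of `l + ρ`. -/
theorem mem_B_iff (l : Weight K m n) (c : PosRoot m n) :
    c ∈ B K l ↔ (c.1.1.1 < m ∧ m ≤ c.1.2.1)
      ∧ (l + rho K : Weight K m n) c.1.1 + (l + rho K : Weight K m n) c.1.2 = 0 := by
  unfold B
  rw [Set.mem_ofPred_eq, isOdd_iff]
  refine and_congr_right fun h => ?_
  rw [form_weight, if_pos h.1, if_neg (by omega), one_mul, neg_one_mul, sub_neg_eq_add]

end Rho

/-! ### Bosonic and fermionic oscillators -/

section ModeSign

variable (K : Type*) [Field K] {ι : Type*} (odd : ι → Prop) [DecidablePred odd]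

/-- The sign of two modes: `-1` if both are odd, `1` otherwise. -/
def modeSign (p q : ι) : K := if odd p ∧ odd q then -1 else 1

variable {K odd}

theorem modeSign_comm (p q : ι) : modeSign K odd p q = modeSign K odd q p := by
  unfold modeSign; simp only [and_comm]

theorem modeSign_mul_self (p q : ι) : modeSign K odd p q * modeSign K odd p q = 1 := by
  unfold modeSign; split_ifs <;> simp

end ModeSign

section Oscillators

variable (K : Type*) [Field K] {ι : Type*} [LinearOrder ι] [Fintype ι]
  (odd : ι → Prop) [DecidablePred odd]

/-- The Jordan–Wigner sign of the mode `p` at the occupation numbers `c`. -/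
def jordanWigner (p : ι) (c : ι → ℤ) : K :=
  if odd p then ∏ q with q < p ∧ odd q, (-1 : K) ^ c q else 1

/-- The operator on functions of the occupation numbers which shifts the mode `p` by `d`, with
coefficient `g`, and with a Jordan–Wigner sign. -/
def ladder (p : ι) (d : ℤ) (g : ℤ → K) : Module.End K ((ι → ℤ) → K) where
  toFun ψ c := jordanWigner K odd p c * g (c p) * ψ (c + Pi.single p d)
  map_add' ψ φ := by ext c; simp [mul_add]
  map_smul' r ψ := by ext c; simp only [Pi.smul_apply, smul_eq_mul, RingHom.id_apply]; ring

variable {K odd}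

theorem ladder_apply (p : ι) (d : ℤ) (g : ℤ → K) (ψ : (ι → ℤ) → K) (c : ι → ℤ) :
    ladder K odd p d g ψ c = jordanWigner K odd p c * g (c p) * ψ (c + Pi.single p d) := rfl

theorem jordanWigner_add_single (p q : ι) (c : ι → ℤ) {d : ℤ} (hd : (-1 : K) ^ d = -1) :
    jordanWigner K odd p (c + Pi.single q d)
      = (if (odd p ∧ odd q) ∧ q < p then -1 else 1) * jordanWigner K odd p c := by
  unfold jordanWigner
  by_cases hp : odd p
  · simp only [hp, if_true, Pi.add_apply, true_and]
    have h1 : (-1 : K) ≠ 0 := neg_ne_zero.2 one_ne_zero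
    simp only [zpow_add₀ h1]
    rw [Finset.prod_mul_distrib, mul_comm]
    congr 1
    have : ∀ r, (-1 : K) ^ (Pi.single (M := fun _ => ℤ) q d r) = if r = q then -1 else 1 := by
      intro r
      by_cases h : r = q
      · subst h; simp [hd]
      · simp [h]
    simp only [this, Finset.prod_ite_eq', Finset.mem_filter, Finset.mem_univ, true_and]
    simp only [and_comm]
  · simp [hp]

theorem jordanWigner_mul_self (p : ι) (c : ι → ℤ) :
    jordanWigner K odd p c * jordanWigner K odd p c = 1 := by
  unfold jordanWigner
  split_ifs with hp
  · rw [← Finset.prod_mul_distrib]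
    refine Finset.prod_eq_one fun q _ => ?_
    rw [← mul_zpow]; simp
  · simp

theorem ladder_supercomm {p q : ι} (hpq : p ≠ q) {d e : ℤ} (hd : (-1 : K) ^ d = -1)
    (he : (-1 : K) ^ e = -1) (g h : ℤ → K) :
    ladder K odd p d g * ladder K odd q e h
      = modeSign K odd p q • (ladder K odd q e h * ladder K odd p d g) := by
  ext ψ c
  simp only [Module.End.mul_apply, LinearMap.smul_apply, Pi.smul_apply, smul_eq_mul, ladder_apply,
    jordanWigner_add_single _ _ _ hd, jordanWigner_add_single _ _ _ he, Pi.add_apply,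
    Pi.single_eq_of_ne hpq, Pi.single_eq_of_ne hpq.symm, add_zero]
  rw [add_right_comm]
  unfold modeSign
  simp only [and_comm (a := odd q) (b := odd p)]
  by_cases ho : odd p ∧ odd q
  · rcases lt_or_gt_of_ne hpq with hlt | hlt <;>
      simp only [ho, hlt, hlt.not_gt, and_true, and_false, if_true, if_false] <;> ring
  · simp only [ho, false_and, if_false]; ring

theorem ladder_mul_same (p : ι) {d e : ℤ} (hd : (-1 : K) ^ d = -1) (g h : ℤ → K)
    (ψ : (ι → ℤ) → K) (c : ι → ℤ) :
    (ladder K odd p d g * ladder K odd p e h) ψ c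
      = g (c p) * h (c p + d) * ψ (c + Pi.single p (d + e)) := by
  simp only [Module.End.mul_apply, ladder_apply, jordanWigner_add_single _ _ _ hd, lt_self_iff_false,
    and_false, if_false, Pi.add_apply, Pi.single_eq_same, add_assoc, ← Pi.single_add]
  linear_combination (g (c p) * h (c p + d) * ψ (c + Pi.single p (d + e)))
    * jordanWigner_mul_self (K := K) (odd := odd) p c

theorem neg_one_zpow_neg_one : (-1 : K) ^ (-1 : ℤ) = -1 := by simp

theorem neg_one_zpow_one : (-1 : K) ^ (1 : ℤ) = -1 := by simp

variable (K odd)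

/-- Coefficients `a p z` and `b p z` for the creation and annihilation operators of the mode `p` at
the occupation number `z` which satisfy the canonical (anti)commutation relations. Occupation
numbers are arbitrary integers. -/
structure OscillatorData (a b : ι → ℤ → K) : Prop where
  comm : ∀ p, ¬ odd p → ∀ z, b p (z + 1) * a p z - a p (z - 1) * b p z = 1
  anticomm : ∀ p, odd p → ∀ z, b p (z + 1) * a p z + a p (z - 1) * b p z = 1
  create : ∀ p, odd p → ∀ z, a p (z + 1) * a p z = 0
  annihilate : ∀ p, odd p → ∀ z, b p (z + 1) * b p z = 0

/-- The creation operator of the mode `p`. -/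
def create (a : ι → ℤ → K) (p : ι) : Module.End K ((ι → ℤ) → K) :=
  ladder K odd p (-1) fun z => a p (z - 1)

/-- The annihilation operator of the mode `p`. -/
def annihilate (b : ι → ℤ → K) (p : ι) : Module.End K ((ι → ℤ) → K) :=
  ladder K odd p 1 fun z => b p (z + 1)

variable {K odd} {a b : ι → ℤ → K}

theorem annihilate_mul_create (h : OscillatorData K odd a b) (p q : ι) :
    annihilate K odd b p * create K odd a q
      = (if p = q then 1 else 0)
        + modeSign K odd p q • (create K odd a q * annihilate K odd b p) := by
  by_cases hpq : p = q
  · subst hpq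
    ext ψ c
    unfold annihilate create
    rw [LinearMap.add_apply, Pi.add_apply, LinearMap.smul_apply, Pi.smul_apply,
      ladder_mul_same _ neg_one_zpow_one, ladder_mul_same _ neg_one_zpow_neg_one]
    simp only [add_neg_cancel, neg_add_cancel, Pi.single_zero, add_zero, if_true, smul_eq_mul,
      add_sub_cancel_right, neg_add_cancel_right, Module.End.one_apply]
    unfold modeSign
    by_cases ho : odd p
    · simp only [ho, and_self, if_true]
      linear_combination ψ c * h.anticomm p ho (c p)
    · simp only [ho, and_self, if_false]
      linear_combination ψ c * h.comm p ho (c p)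
  · rw [if_neg hpq, zero_add]
    exact ladder_supercomm hpq neg_one_zpow_one neg_one_zpow_neg_one _ _

theorem create_mul_create (h : OscillatorData K odd a b) (p q : ι) :
    create K odd a p * create K odd a q
      = modeSign K odd p q • (create K odd a q * create K odd a p) := by
  by_cases hpq : p = q
  · subst hpq
    by_cases ho : odd p
    · have : create K odd a p * create K odd a p = 0 := by
        ext ψ c
        unfold create
        rw [ladder_mul_same _ neg_one_zpow_neg_one]
        have := h.create p ho (c p - 1 - 1)
        rw [sub_add_cancel] at this
        rw [← sub_eq_add_neg, this]; simp
      rw [this, smul_zero]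
    · simp [modeSign, ho]
  · exact ladder_supercomm hpq neg_one_zpow_neg_one neg_one_zpow_neg_one _ _

theorem annihilate_mul_annihilate (h : OscillatorData K odd a b) (p q : ι) :
    annihilate K odd b p * annihilate K odd b q
      = modeSign K odd p q • (annihilate K odd b q * annihilate K odd b p) := by
  by_cases hpq : p = q
  · subst hpq
    by_cases ho : odd p
    · have : annihilate K odd b p * annihilate K odd b p = 0 := by
        ext ψ c
        unfold annihilate
        rw [ladder_mul_same _ neg_one_zpow_one]
        have := h.annihilate p ho (c p + 1)
        rw [mul_comm] at this
        rw [this]; simp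
      rw [this, smul_zero]
    · simp [modeSign, ho]
  · exact ladder_supercomm hpq neg_one_zpow_one neg_one_zpow_one _ _

/-- The supercommutation rule of two quadratic expressions (creation times annihilation). -/
theorem create_annihilate_mul (h : OscillatorData K odd a b) (p q r s : ι) :
    create K odd a p * annihilate K odd b q * (create K odd a r * annihilate K odd b s)
      = (if q = r then create K odd a p * annihilate K odd b s else 0)
        + (modeSign K odd p r * modeSign K odd q r * modeSign K odd p s * modeSign K odd q s) •
          (create K odd a r * annihilate K odd b s * (create K odd a p * annihilate K odd b q)
            - if p = s then create K odd a r * annihilate K odd b q else 0) := by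
  have h1 := annihilate_mul_create h q r
  have h2 := create_mul_create h p r
  have h3 := annihilate_mul_annihilate h q s
  have h4 : create K odd a p * annihilate K odd b s = modeSign K odd p s •
      (annihilate K odd b s * create K odd a p - if p = s then 1 else 0) := by
    rw [annihilate_mul_create h s p, modeSign_comm s p]
    simp only [eq_comm (a := s)]
    rw [add_sub_cancel_left, smul_smul, modeSign_mul_self, one_smul]
  calc create K odd a p * annihilate K odd b q * (create K odd a r * annihilate K odd b s)
      = create K odd a p * (annihilate K odd b q * create K odd a r) * annihilate K odd b s := by
        noncomm_ring
    _ = create K odd a p * (if q = r then 1 else 0) * annihilate K odd b s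
        + modeSign K odd q r • ((create K odd a p * create K odd a r)
            * (annihilate K odd b q * annihilate K odd b s)) := by
        rw [h1, mul_add, add_mul]
        simp only [mul_smul_comm, smul_mul_assoc, mul_assoc]
    _ = create K odd a p * (if q = r then 1 else 0) * annihilate K odd b s
        + (modeSign K odd q r * modeSign K odd q s * modeSign K odd p r) •
          (create K odd a r * (create K odd a p * annihilate K odd b s)
            * annihilate K odd b q) := by
        rw [h2, h3]
        simp only [mul_smul_comm, smul_mul_assoc, mul_assoc, smul_smul]
    _ = _ := by
        conv_lhs => rw [h4]
        simp only [mul_smul_comm, smul_mul_assoc, smul_smul, mul_sub, sub_mul]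
        congr 1
        · split_ifs <;> simp
        · congr 1
          · ring
          · congr 1
            split_ifs <;> simp

end Oscillators

/-! ### An oscillator representation with a vacuum of given highest weight -/

section Fock

variable {K : Type*} [Field K] {m n : ℕ}

variable (m n) in
/-- The modes: the index `i` of the natural module in its `k`-th copy is `toLex (i, k)`. -/
abbrev Mode := Fin (m + n) ×ₗ Fin (m + n)

/-- The mode `(i, k)` is odd if the parities of `i` and of `k` differ. -/
def Mode.Odd (p : Mode m n) : Prop := ¬ ((ofLex p).1.1 < m ↔ (ofLex p).2.1 < m)

instance : DecidablePred (Mode.Odd (m := m) (n := n)) :=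
  fun _ => inferInstanceAs (Decidable (¬ _))

/-- Coefficients of the creation operators. Odd modes are occupied or not according to the parity
of `z`. For the even modes `(i, k)` with `k < i` the operators are the usual ones, with a vacuum
killed by annihilation; for `i < k` the vacuum is killed by creation; for `i = k` neither operator
kills it, and `e_{k,k}` has the eigenvalue `z + μ k` on the mode. -/
def createCoeff (μ : Fin (m + n) → K) (p : Mode m n) (z : ℤ) : K :=
  if p.Odd then (if Even z then 1 else 0)
  else if (ofLex p).2 < (ofLex p).1 then 1
  else if (ofLex p).1 < (ofLex p).2 then z else z + 1 + μ (ofLex p).2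

/-- Coefficients of the annihilation operators, see `createCoeff`. -/
def annihilateCoeff (p : Mode m n) (z : ℤ) : K :=
  if p.Odd then (if Even z then 0 else 1)
  else if (ofLex p).2 < (ofLex p).1 then z else 1

theorem oscillatorData (μ : Fin (m + n) → K) :
    OscillatorData K (Mode.Odd (m := m) (n := n)) (createCoeff μ) annihilateCoeff where
  comm p hp z := by
    unfold createCoeff annihilateCoeff
    simp only [hp, if_false]
    split_ifs <;> push_cast <;> ring
  anticomm p hp z := by
    unfold createCoeff annihilateCoeff
    simp only [hp, if_true, Int.even_add_one, Int.even_sub_one]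
    by_cases h : Even z <;> simp [h]
  create p hp z := by
    unfold createCoeff
    simp only [hp, if_true, Int.even_add_one]
    by_cases h : Even z <;> simp [h]
  annihilate p hp z := by
    unfold annihilateCoeff
    simp only [hp, if_true, Int.even_add_one]
    by_cases h : Even z <;> simp [h]

variable (K m n) in
/-- The Fock space: arbitrary functions of the occupation numbers. Finiteness of the support is not
needed. -/
abbrev Fock := (Mode m n → ℤ) → K

/-- The term of `fockUnit` in the `k`-th copy. -/
def fockTerm (μ : Fin (m + n) → K) (i j k : Fin (m + n)) : Module.End K (Fock K m n) :=
  create K Mode.Odd (createCoeff μ) (toLex (i, k))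
    * annihilate K Mode.Odd annihilateCoeff (toLex (j, k))

/-- The action of the matrix unit `e_{i,j}` on the Fock space. -/
def fockUnit (μ : Fin (m + n) → K) (i j : Fin (m + n)) : Module.End K (Fock K m n) :=
  ∑ k, fockTerm μ i j k

/-- The signs from moving the oscillators of the `c`-th copy past those of the `d`-th one: the parities
of the copies cancel. -/
theorem modeSign_prod (i j k l c d : Fin (m + n)) :
    modeSign K Mode.Odd (toLex (i, c)) (toLex (k, d))
      * modeSign K Mode.Odd (toLex (j, c)) (toLex (k, d))
      * modeSign K Mode.Odd (toLex (i, c)) (toLex (l, d))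
      * modeSign K Mode.Odd (toLex (j, c)) (toLex (l, d)) = unitSign K m i j k l := by
  unfold modeSign unitSign Mode.Odd
  simp only [ofLex_toLex]
  by_cases hi : i.1 < m <;> by_cases hj : j.1 < m <;> by_cases hk : k.1 < m <;>
    by_cases hl : l.1 < m <;> by_cases hc : c.1 < m <;> by_cases hd : d.1 < m <;>
    simp [hi, hj, hk, hl, hc, hd]

theorem fockUnit_mul (μ : Fin (m + n) → K) (i j k l : Fin (m + n)) :
    fockUnit μ i j * fockUnit μ k l
      = (if j = k then fockUnit μ i l else 0)
        + unitSign K m i j k l • (fockUnit μ k l * fockUnit μ i j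
          - if i = l then fockUnit μ k j else 0) := by
  have key : ∀ c d, fockTerm μ i j c * fockTerm μ k l d
      = (if d = c then (if j = k then fockTerm μ i l c else 0) else 0)
        + unitSign K m i j k l • (fockTerm μ k l d * fockTerm μ i j c
          - if d = c then (if i = l then fockTerm μ k j c else 0) else 0) := by
    intro c d
    unfold fockTerm
    rw [create_annihilate_mul (oscillatorData μ), modeSign_prod]
    have h1 : ∀ i j : Fin (m + n), ((toLex (i, c) : Mode m n) = toLex (j, d)) ↔ d = c ∧ i = j := by
      intro i j; rw [toLex_inj, Prod.mk.injEq]; tauto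
    simp only [h1, ite_and]
    by_cases hdc : d = c
    · subst hdc; rfl
    · simp [hdc]
  unfold fockUnit
  rw [Finset.sum_mul_sum, Finset.sum_mul_sum]
  simp only [key, Finset.sum_add_distrib, ← Finset.smul_sum, Finset.sum_sub_distrib,
    Finset.sum_ite_eq', Finset.mem_univ, if_true]
  rw [Finset.sum_comm (f := fun c d => fockTerm μ k l d * fockTerm μ i j c)]
  congr 1
  · split_ifs <;> simp
  · split_ifs <;> simp

/-- The action of `gl(m,n)` on the Fock space. -/
def fockLin (μ : Fin (m + n) → K) : gl K m n →ₗ[K] Module.End K (Fock K m n) where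
  toFun x := ∑ i, ∑ j, x i j • fockUnit μ i j
  map_add' x y := by simp [add_smul, Finset.sum_add_distrib]
  map_smul' r x := by simp [mul_smul, Finset.smul_sum]

theorem fockLin_mul (μ : Fin (m + n) → K) (x y : gl K m n) :
    fockLin μ (x * y) = ∑ i, ∑ j, ∑ k, ∑ l, (x i j * y k l) •
      (if j = k then fockUnit μ i l else 0) := by
  simp only [fockLin, LinearMap.coe_mk, AddHom.coe_mk, Matrix.mul_apply, Finset.sum_smul]
  refine Finset.sum_congr rfl fun i _ => ?_
  rw [Finset.sum_comm]
  refine Finset.sum_congr rfl fun j _ => ?_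
  rw [Finset.sum_comm]
  refine Finset.sum_congr rfl fun l _ => ?_
  simp

theorem fockLin_bracket (μ : Fin (m + n) → K) (p q : ZMod 2) (x y : gl K m n)
    (hx : IsHomogeneous K m n p x) (hy : IsHomogeneous K m n q y) :
    fockLin μ x * fockLin μ y - superSign K p q • (fockLin μ y * fockLin μ x)
      = fockLin μ (x * y - superSign K p q • (y * x)) := by
  have hswap : ∀ f : Fin (m + n) → Fin (m + n) → Fin (m + n) → Fin (m + n)
      → Module.End K (Fock K m n),
      ∑ i, ∑ j, ∑ k, ∑ l, f i j k l = ∑ k, ∑ l, ∑ i, ∑ j, f i j k l := by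
    intro f
    calc ∑ i, ∑ j, ∑ k, ∑ l, f i j k l = ∑ i, ∑ k, ∑ j, ∑ l, f i j k l :=
          Finset.sum_congr rfl fun _ _ => Finset.sum_comm
      _ = ∑ k, ∑ i, ∑ j, ∑ l, f i j k l := Finset.sum_comm
      _ = ∑ k, ∑ i, ∑ l, ∑ j, f i j k l :=
          Finset.sum_congr rfl fun _ _ => Finset.sum_congr rfl fun _ _ => Finset.sum_comm
      _ = _ := Finset.sum_congr rfl fun _ _ => Finset.sum_comm
  have hxy : ∀ x y : gl K m n, fockLin μ x * fockLin μ y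
      = ∑ i, ∑ j, ∑ k, ∑ l, (x i j * y k l) • (fockUnit μ i j * fockUnit μ k l) := by
    intro x y
    simp only [fockLin, LinearMap.coe_mk, AddHom.coe_mk, Finset.sum_mul, Finset.mul_sum,
      smul_mul_smul_comm]
    exact hswap _
  rw [map_sub, map_smul, fockLin_mul, fockLin_mul, hxy, hxy, hswap (fun i j k l =>
    (y i j * x k l) • (fockUnit μ i j * fockUnit μ k l)), hswap (fun i j k l =>
    (y i j * x k l) • (if j = k then fockUnit μ i l else 0))]
  simp only [Finset.smul_sum, ← Finset.sum_sub_distrib]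
  refine Finset.sum_congr rfl fun i _ => Finset.sum_congr rfl fun j _ =>
    Finset.sum_congr rfl fun k _ => Finset.sum_congr rfl fun l _ => ?_
  by_cases h1 : x i j = 0
  · simp [h1]
  by_cases h2 : y k l = 0
  · simp [h2]
  have hs : superSign K p q = unitSign K m i j k l := by
    rw [← hx i j h1, ← hy k l h2, superSign_parity]
  rw [hs, fockUnit_mul μ i j k l, mul_comm (y k l)]
  simp only [eq_comm (a := l)]
  module

/-- The action of the enveloping algebra on the Fock space. -/
def fockHom (μ : Fin (m + n) → K) : U K m n →ₐ[K] Module.End K (Fock K m n) :=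
  RingQuot.liftAlgHom K ⟨TensorAlgebra.lift K (fockLin μ), by
    rintro _ _ ⟨p, q, x, y, hx, hy⟩
    simpa using fockLin_bracket μ p q x y hx hy⟩

theorem fockHom_matUnit (μ : Fin (m + n) → K) (i j : Fin (m + n)) :
    fockHom μ (matUnit K m n i j) = fockUnit μ i j := by
  rw [matUnit_fin]
  simp only [fockHom, toU, LinearMap.comp_apply, AlgHom.toLinearMap_apply,
    RingQuot.liftAlgHom_mkAlgHom_apply, TensorAlgebra.lift_ι_apply]
  simp only [fockLin, LinearMap.coe_mk, AddHom.coe_mk]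
  rw [Finset.sum_eq_single i, Finset.sum_eq_single j]
  · simp
  · intro k _ hk; simp [hk.symm]
  · simp
  · intro k _ hk; simp [hk.symm]
  · simp

end Fock

/-! ### The vacuum -/

section Vacuum

variable {K : Type*} [Field K] {m n : ℕ}

theorem fockTerm_apply (μ : Fin (m + n) → K) (i j k : Fin (m + n)) (ψ : Fock K m n)
    (c : Mode m n → ℤ) :
    fockTerm μ i j k ψ c
      = jordanWigner K Mode.Odd (toLex (i, k)) c * createCoeff μ (toLex (i, k)) (c (toLex (i, k)) - 1)
        * (jordanWigner K Mode.Odd (toLex (j, k)) (c + Pi.single (toLex (i, k)) (-1))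
          * annihilateCoeff (toLex (j, k))
            ((c + Pi.single (toLex (i, k)) (-1) : Mode m n → ℤ) (toLex (j, k)) + 1)
          * ψ (c + Pi.single (toLex (i, k)) (-1) + Pi.single (toLex (j, k)) 1)) := rfl

/-- The eigenvalue of `e_{i,i}` at given occupation numbers. -/
def occWeight (μ : Fin (m + n) → K) (i : Fin (m + n)) (c : Mode m n → ℤ) : K :=
  ∑ k, createCoeff μ (toLex (i, k)) (c (toLex (i, k)) - 1)
    * annihilateCoeff (toLex (i, k)) (c (toLex (i, k)))

theorem fockUnit_diag_apply (μ : Fin (m + n) → K) (i : Fin (m + n)) (ψ : Fock K m n)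
    (c : Mode m n → ℤ) : fockUnit μ i i ψ c = occWeight μ i c * ψ c := by
  unfold fockUnit occWeight
  rw [LinearMap.sum_apply, Finset.sum_apply, Finset.sum_mul]
  refine Finset.sum_congr rfl fun k _ => ?_
  unfold fockTerm create annihilate
  rw [ladder_mul_same _ neg_one_zpow_neg_one]
  simp

/-- A vector in the span of weight vectors which has weight `w` is in the span of those of
weight `w`. -/
theorem mem_span_of_weight (μ : Fin (m + n) → K) (S : Set (Fock K m n))
    (hS : ∀ x ∈ S, ∃ v : Fin (m + n) → K, ∀ i, fockUnit μ i i x = v i • x)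
    (w : Fin (m + n) → K) {y : Fock K m n} (hy : ∀ i, fockUnit μ i i y = w i • y)
    (hyS : y ∈ Submodule.span K S) :
    y ∈ Submodule.span K {x ∈ S | ∀ i, fockUnit μ i i x = w i • x} := by
  classical
  let P : Fock K m n →ₗ[K] Fock K m n :=
    { toFun := fun ψ c => if ∀ i, occWeight μ i c = w i then ψ c else 0
      map_add' := fun ψ φ => by ext c; by_cases h : ∀ i, occWeight μ i c = w i <;> simp [h]
      map_smul' := fun r ψ => by ext c; by_cases h : ∀ i, occWeight μ i c = w i <;> simp [h] }
  have hval : ∀ (x : Fock K m n) (v : Fin (m + n) → K), (∀ i, fockUnit μ i i x = v i • x) →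
      ∀ c, x c ≠ 0 → ∀ i, occWeight μ i c = v i := by
    intro x v hx c hc i
    have := congrFun (hx i) c
    rw [fockUnit_diag_apply, Pi.smul_apply, smul_eq_mul] at this
    exact mul_right_cancel₀ hc this
  have hPw : ∀ x : Fock K m n, (∀ i, fockUnit μ i i x = w i • x) → P x = x := by
    intro x hx
    ext c
    by_cases hc : x c = 0
    · simp [P, hc]
    · simp [P, hval x w hx c hc]
  rw [← hPw y hy]
  have := Submodule.mem_map_of_mem (f := P) hyS
  rw [Submodule.map_span] at this
  refine Submodule.span_le.2 ?_ this
  rintro _ ⟨x, hx, rfl⟩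
  obtain ⟨v, hv⟩ := hS x hx
  by_cases hvw : v = w
  · subst hvw
    rw [hPw x hv]
    exact Submodule.subset_span ⟨hx, hv⟩
  · have : P x = 0 := by
      ext c
      by_cases hc : x c = 0
      · simp [P, hc]
      · have h1 := hval x v hv c hc
        have h2 : ¬ ∀ i, occWeight μ i c = w i := fun h2 =>
          hvw (funext fun i => (h1 i).symm.trans (h2 i))
        simp [P, h2]
    rw [this]
    exact zero_mem _

/-- The occupation numbers of the vacuum: the odd modes `(i, k)` with `i < k`, on which creation
has to act by `0`, are occupied, all other modes are empty. -/
def vacOcc (p : Mode m n) : ℤ := if p.Odd ∧ (ofLex p).1 < (ofLex p).2 then 1 else 0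

variable (K m n) in
/-- The vacuum, a singular vector of the Fock space. -/
def vacuum : Fock K m n := fun c => if c = vacOcc then 1 else 0

theorem vacuum_ne_zero : vacuum K m n ≠ 0 := fun h => by
  have := congrFun h vacOcc
  simp [vacuum] at this

theorem vacuum_apply_of_ne {c : Mode m n → ℤ} (p : Mode m n) (h : c p ≠ vacOcc p) :
    vacuum K m n c = 0 := if_neg fun hc => h (by rw [hc])

theorem fockUnit_vacuum_of_lt (μ : Fin (m + n) → K) {i j : Fin (m + n)} (hij : i < j) :
    fockUnit μ i j (vacuum K m n) = 0 := by
  unfold fockUnit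
  rw [LinearMap.sum_apply]
  refine Finset.sum_eq_zero fun k _ => ?_
  by_cases hkj : k < j
  · have : annihilate K Mode.Odd annihilateCoeff (toLex (j, k)) (vacuum K m n) = 0 := by
      ext c
      unfold annihilate
      rw [ladder_apply]
      by_cases hc : c (toLex (j, k)) + 1 = 0
      · simp [hc, annihilateCoeff, hkj]
      · rw [vacuum_apply_of_ne (toLex (j, k))]
        · simp
        · simpa [vacOcc, hkj.not_gt] using hc
    unfold fockTerm
    rw [Module.End.mul_apply, this, map_zero]
  · have hik : i < k := lt_of_lt_of_le hij (not_lt.1 hkj)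
    have : create K Mode.Odd (createCoeff μ) (toLex (i, k)) (vacuum K m n) = 0 := by
      ext c
      unfold create
      rw [ladder_apply]
      by_cases hc : c (toLex (i, k)) - 1 = vacOcc (toLex (i, k))
      · have : createCoeff μ (toLex (i, k)) (vacOcc (toLex (i, k))) = 0 := by
          unfold createCoeff vacOcc
          by_cases ho : Mode.Odd (toLex (i, k) : Mode m n) <;> simp [ho, hik, hik.not_gt]
        simp [hc, this]
      · rw [vacuum_apply_of_ne (toLex (i, k))]
        · simp
        · simpa [sub_eq_add_neg] using hc
    unfold fockTerm create annihilate
    rw [ladder_supercomm (by simpa [toLex_inj] using hij.ne) neg_one_zpow_neg_one neg_one_zpow_one,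
      LinearMap.smul_apply, Module.End.mul_apply]
    unfold create at this
    rw [this, map_zero, smul_zero]

/-- The parameters of the Fock space whose vacuum has weight `l`. -/
def fockParam (l : Weight K m n) (i : Fin (m + n)) : K :=
  l i - ∑ k, if i < k then (if (i.1 < m ↔ k.1 < m) then -1 else 1) else 0

theorem fockUnit_vacuum_diag (l : Weight K m n) (i : Fin (m + n)) :
    fockUnit (fockParam l) i i (vacuum K m n) = l i • vacuum K m n := by
  ext c
  rw [fockUnit_diag_apply, Pi.smul_apply, smul_eq_mul]
  by_cases hc : c = vacOcc
  · subst hc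
    congr 1
    unfold occWeight
    have : ∀ k : Fin (m + n), createCoeff (fockParam l) (toLex (i, k)) (vacOcc (toLex (i, k)) - 1)
        * annihilateCoeff (toLex (i, k)) (vacOcc (toLex (i, k)))
        = (if k = i then fockParam l i else 0)
          + if i < k then (if (i.1 < m ↔ k.1 < m) then -1 else 1) else 0 := by
      intro k
      unfold createCoeff annihilateCoeff vacOcc Mode.Odd
      simp only [ofLex_toLex]
      rcases lt_trichotomy i k with h | h | h
      · by_cases ho : (i.1 < m ↔ k.1 < m) <;> simp [ho, h, h.not_gt, h.ne']
      · subst h; simp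
      · by_cases ho : (i.1 < m ↔ k.1 < m) <;> simp [ho, h, h.not_gt, h.ne]
    simp only [this, Finset.sum_add_distrib, Finset.sum_ite_eq', Finset.mem_univ, if_true]
    unfold fockParam
    ring
  · simp [vacuum, hc]

/-- Vectors supported on occupation numbers which vanish on the modes `(i, k)` with `k ≤ i`: the
`k`-th copy of the natural module has not been excited yet. -/
def freshCopy (k : ℕ) : Submodule K (Fock K m n) where
  carrier := {ψ | ∀ c, ψ c ≠ 0 → ∀ i κ : Fin (m + n), κ.1 = k → κ ≤ i → c (toLex (i, κ)) = 0}
  zero_mem' c hc := absurd rfl hc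
  add_mem' {ψ φ} hψ hφ c hc := by
    by_cases h : ψ c = 0
    · refine hφ c fun h' => hc ?_
      rw [Pi.add_apply, h, h', add_zero]
    · exact hψ c h
  smul_mem' r ψ hψ c hc := hψ c fun h => hc (by rw [Pi.smul_apply, h, smul_zero])

theorem mem_freshCopy {k : ℕ} {ψ : Fock K m n} : ψ ∈ freshCopy k ↔
    ∀ c, ψ c ≠ 0 → ∀ i κ : Fin (m + n), κ.1 = k → κ ≤ i → c (toLex (i, κ)) = 0 := Iff.rfl

theorem vacuum_mem_freshCopy (k : ℕ) : vacuum K m n ∈ freshCopy k := by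
  rw [mem_freshCopy]
  intro c hc i κ _ hi
  by_contra h
  refine hc (vacuum_apply_of_ne (toLex (i, κ)) ?_)
  simpa [vacOcc, hi.not_gt] using h

theorem mode_ne {i j k l : Fin (m + n)} (h : i ≠ j ∨ k ≠ l) :
    (toLex (i, k) : Mode m n) ≠ toLex (j, l) := by
  rw [Ne, toLex_inj, Prod.mk.injEq]; tauto

theorem fockUnit_mem_freshCopy (μ : Fin (m + n) → K) {k : ℕ} {i j : Fin (m + n)}
    (hj : k < j.1) {ψ : Fock K m n} (hψ : ψ ∈ freshCopy k) :
    fockUnit μ i j ψ ∈ freshCopy k := by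
  unfold fockUnit
  rw [LinearMap.sum_apply]
  refine Submodule.sum_mem _ fun c _ => ?_
  by_cases hck : c.1 = k
  · have : annihilate K Mode.Odd annihilateCoeff (toLex (j, c)) ψ = 0 := by
      ext N
      unfold annihilate
      rw [ladder_apply]
      by_cases hN : ψ (N + Pi.single (toLex (j, c)) 1) = 0
      · simp [hN]
      · have hcj : c < j := by rw [Fin.lt_def]; omega
        have := hψ _ hN j c hck hcj.le
        rw [Pi.add_apply, Pi.single_eq_same] at this
        simp [this, annihilateCoeff, hcj]
    unfold fockTerm
    rw [Module.End.mul_apply, this, map_zero]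
    exact zero_mem _
  · rw [mem_freshCopy]
    intro N hN i' κ hκ hi'
    rw [fockTerm_apply] at hN
    have h1 := hψ _ (right_ne_zero_of_mul (right_ne_zero_of_mul hN)) i' κ hκ hi'
    have hne : κ ≠ c := by rintro rfl; exact hck hκ
    simpa [Pi.single_eq_of_ne (mode_ne (Or.inr hne))] using h1

/-- The matrix units `e_{q,k}` with `k < q` act freely on vectors which do not involve the modes
`(i, k)`: the term in the `k`-th copy can be read off. -/
theorem eq_zero_of_sum_fockUnit (μ : Fin (m + n) → K) (k : Fin (m + n)) (s : Finset (Fin (m + n)))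
    (hs : ∀ q ∈ s, k < q) (ψ : Fin (m + n) → Fock K m n) (hψ : ∀ q ∈ s, ψ q ∈ freshCopy k.1)
    (h0 : ∑ q ∈ s, fockUnit μ q k (ψ q) = 0) {q : Fin (m + n)} (hq : q ∈ s) : ψ q = 0 := by
  ext N
  by_contra hN
  -- Moving a particle of `N` from the mode `(k, k)` to the mode `(q, k)` gives occupation numbers
  -- which only the term of `q` in the `k`-th copy can reach.
  have hkq := hs q hq
  have hN' := hψ q hq N hN
  set N' : Mode m n → ℤ := N + Pi.single (toLex (q, k)) 1 + Pi.single (toLex (k, k)) (-1) with hN'def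
  have hkk : N' (toLex (k, k)) = -1 := by
    simp [hN'def, hN' k k rfl le_rfl, Pi.single_eq_of_ne (mode_ne (Or.inl hkq.ne) :
      (toLex (k, k) : Mode m n) ≠ toLex (q, k))]
  have hqk : N' (toLex (q, k)) = 1 := by
    simp [hN'def, hN' q k rfl hkq.le, Pi.single_eq_of_ne (mode_ne (Or.inl hkq.ne') :
      (toLex (q, k) : Mode m n) ≠ toLex (k, k))]
  have h1 := congrFun h0 N'
  rw [Finset.sum_apply] at h1
  unfold fockUnit at h1
  simp only [LinearMap.sum_apply, Finset.sum_apply, Pi.zero_apply] at h1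
  have hterm : ∀ p ∈ s, ∀ c, (p ≠ q ∨ c ≠ k) → fockTerm μ p k c (ψ p) N' = 0 := by
    intro p hp c hpc
    rw [fockTerm_apply]
    by_contra h2
    have h3 := hψ p hp _ (right_ne_zero_of_mul (right_ne_zero_of_mul h2))
    by_cases hc : c = k
    · subst hc
      have h4 := h3 q c rfl hkq.le
      have hpq : p ≠ q := by tauto
      rw [Pi.add_apply, Pi.add_apply, hqk, Pi.single_eq_of_ne (mode_ne (Or.inl hpq.symm)),
        Pi.single_eq_of_ne (mode_ne (Or.inl hkq.ne'))] at h4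
      norm_num at h4
    · have h4 := h3 k k rfl le_rfl
      rw [Pi.add_apply, Pi.add_apply, hkk, Pi.single_eq_of_ne (mode_ne (Or.inr (Ne.symm hc))),
        Pi.single_eq_of_ne (mode_ne (Or.inr (Ne.symm hc)))] at h4
      norm_num at h4
  rw [Finset.sum_eq_single_of_mem q hq, Finset.sum_eq_single_of_mem k (Finset.mem_univ _)] at h1
  · rw [fockTerm_apply, hqk, Pi.add_apply, hkk, Pi.single_eq_of_ne (mode_ne (Or.inl hkq.ne))] at h1
    have h5 : N' + Pi.single (toLex (q, k)) (-1) + Pi.single (toLex (k, k)) 1 = N := by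
      rw [hN'def]
      have e1 : (Pi.single (toLex (q, k)) 1 : Mode m n → ℤ) + Pi.single (toLex (q, k)) (-1) = 0 := by
        rw [← Pi.single_add]; simp
      have e2 : (Pi.single (toLex (k, k)) (-1) : Mode m n → ℤ) + Pi.single (toLex (k, k)) 1 = 0 := by
        rw [← Pi.single_add]; simp
      linear_combination e1 + e2
    rw [h5] at h1
    have hjw : ∀ (p : Mode m n) c, jordanWigner K Mode.Odd p c ≠ 0 := fun p c =>
      left_ne_zero_of_mul_eq_one (jordanWigner_mul_self p c)
    have ha : createCoeff μ (toLex (q, k) : Mode m n) (1 - 1) = 1 := by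
      simp [createCoeff, hkq]
    have hb : annihilateCoeff (K := K) (toLex (k, k) : Mode m n) (-1 + 0 + 1) = 1 := by
      simp [annihilateCoeff, Mode.Odd]
    rw [ha, hb, mul_one, mul_one] at h1
    exact mul_ne_zero (hjw _ _) (mul_ne_zero (hjw _ _) hN) h1
  · intro c _ hc
    exact hterm q hq c (Or.inr hc)
  · intro p hp hpq
    exact Finset.sum_eq_zero fun c _ => hterm p hp c (Or.inl hpq)

end Vacuum

/-! ### The Fock space as a highest weight representation -/

section FockRep

variable {K : Type*} [Field K] {m n : ℕ}

/-- The action of the enveloping algebra on the Fock space whose vacuum has weight `l`. -/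
def fockRep (l : Weight K m n) : U K m n →ₐ[K] Module.End K (Fock K m n) := fockHom (fockParam l)

theorem fockRep_raising (l : Weight K m n) {i j : ℕ} (hij : i < j) :
    fockRep l (matUnit K m n i j) (vacuum K m n) = 0 := by
  by_cases h : i < m + n ∧ j < m + n
  · have := fockHom_matUnit (fockParam l) ⟨i, h.1⟩ ⟨j, h.2⟩
    unfold fockRep
    rw [show matUnit K m n i j = matUnit K m n (⟨i, h.1⟩ : Fin (m + n)) (⟨j, h.2⟩ : Fin (m + n))
      from rfl, this]
    exact fockUnit_vacuum_of_lt _ hij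
  · simp [matUnit, h]

theorem fockRep_diag (l : Weight K m n) (i : Fin (m + n)) :
    fockRep l (matUnit K m n i i) (vacuum K m n) = l i • vacuum K m n := by
  unfold fockRep
  rw [fockHom_matUnit, fockUnit_vacuum_diag]

theorem fockRep_mem_freshCopy (l : Weight K m n) {k i j : ℕ} (hj : k < j)
    {ψ : Fock K m n} (hψ : ψ ∈ freshCopy k) :
    fockRep l (matUnit K m n i j) ψ ∈ freshCopy k := by
  by_cases h : i < m + n ∧ j < m + n
  · have := fockHom_matUnit (fockParam l) ⟨i, h.1⟩ ⟨j, h.2⟩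
    unfold fockRep
    rw [show matUnit K m n i j = matUnit K m n (⟨i, h.1⟩ : Fin (m + n)) (⟨j, h.2⟩ : Fin (m + n))
      from rfl, this]
    exact fockUnit_mem_freshCopy _ hj hψ
  · simp [matUnit, h]

/-- The lowering operators `e_{q,k}` are independent of each other on `freshCopy k`. This takes the place
of a Poincaré–Birkhoff–Witt theorem. -/
theorem eq_zero_of_sum_lowering (l : Weight K m n) {k b : ℕ} (hb : b < m + n)
    (ψ : ℕ → Fock K m n) (hψ : ∀ q ∈ Finset.Ioc k b, ψ q ∈ freshCopy k)
    (h0 : ∑ q ∈ Finset.Ioc k b, fockRep l (matUnit K m n q k) (ψ q) = 0) {q : ℕ}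
    (hq : q ∈ Finset.Ioc k b) : ψ q = 0 := by
  have hkb := Finset.mem_Ioc.1 hq
  have hbij : ∑ q ∈ Finset.Ioc k b, fockRep l (matUnit K m n q k) (ψ q)
      = ∑ q : Fin (m + n) with q.1 ∈ Finset.Ioc k b,
        fockUnit (fockParam l) q ⟨k, by omega⟩ (ψ q) := by
    symm
    refine Finset.sum_bij (fun q _ => q.1) (by simp) (fun _ _ _ _ h => Fin.ext h) ?_ ?_
    · intro p hp
      have := Finset.mem_Ioc.1 hp
      exact ⟨⟨p, by omega⟩, by simpa using this, rfl⟩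
    · intro p _
      rw [← fockHom_matUnit]; rfl
  rw [hbij] at h0
  refine eq_zero_of_sum_fockUnit (fockParam l) ⟨k, by omega⟩ _ ?_ (fun q => ψ q) ?_ h0
    (q := ⟨q, by omega⟩) ?_
  · intro p hp
    rw [Fin.lt_def]
    exact (Finset.mem_Ioc.1 (Finset.mem_filter.1 hp).2).1
  · intro p hp
    exact hψ p (Finset.mem_filter.1 hp).2
  · simpa using hkb

/-- The Verma module maps to the Fock space, with `v_l` going to the vacuum. -/
theorem fockRep_vermaIdeal (l : Weight K m n) {u : U K m n} (hu : u ∈ vermaIdeal K l) :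
    fockRep l u (vacuum K m n) = 0 := by
  induction hu using Submodule.span_induction with
  | mem x hx =>
    rcases hx with ⟨y, hy, rfl⟩ | ⟨a, rfl⟩
    · have hy' : ∀ i j : Fin (m + n), j ≤ i → y i j = 0 := hy
      rw [toU_eq_sum]
      simp only [map_sum, map_smul, LinearMap.sum_apply, LinearMap.smul_apply]
      refine Finset.sum_eq_zero fun i _ => Finset.sum_eq_zero fun j _ => ?_
      by_cases hij : j ≤ i
      · rw [hy' i j hij, zero_smul]
      · rw [fockRep_raising l (not_le.1 hij), smul_zero]
    · simp only [toU_diagonal, map_sub, map_sum, map_smul, LinearMap.sub_apply, LinearMap.sum_apply,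
        LinearMap.smul_apply, fockRep_diag, AlgHom.commutes, Module.algebraMap_end_apply,
        smul_smul]
      rw [sub_eq_zero]
      exact Finset.sum_congr rfl fun i _ => by rw [mul_comm]
  | zero => simp
  | add x y _ _ hx hy => rw [map_add, LinearMap.add_apply, hx, hy, add_zero]
  | smul a x _ hx => rw [smul_eq_mul, map_mul, Module.End.mul_apply, hx, map_zero]

end FockRep

/-! ### Sums over chains -/

section ChainSums

variable {K : Type*} [Field K] {m n : ℕ}

theorem matUnit_commute {i j k l : ℕ} (hi : i < m + n) (hj : j < m + n) (hk : k < m + n)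
    (hl : l < m + n) (hjk : j ≠ k) (hil : i ≠ l) (hs : (i < m ↔ j < m) ∨ (k < m ↔ l < m)) :
    Commute (matUnit K m n i j) (matUnit K m n k l) := by
  have h := matUnit_mul (K := K) hi hj hk hl
  rw [unitSign_eq_one hs, if_neg hjk, if_neg hil] at h
  simpa [Commute, SemiconjBy] using h

theorem lowering_mul_lowering {p q r : ℕ} (hpq : p < q) (hqr : q < r) (hr : r < m + n) :
    matUnit K m n r q * matUnit K m n q p
      = matUnit K m n q p * matUnit K m n r q + matUnit K m n r p := by
  have h := matUnit_mul (K := K) (m := m) hr (hqr.trans hr) (hqr.trans hr)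
    ((hpq.trans hqr).trans hr)
  rw [unitSign_eq_one (by omega), if_pos rfl, if_neg (by omega)] at h
  simpa using h

/-- `IsChainSum b p u t`: the element `u` is a linear combination of the products
`e_{i₁,p} e_{i₂,i₁} ⋯ e_{b,i_k}` over the chains `p < i₁ < ⋯ < i_k < b`, and the coefficient of the
full chain `p < p + 1 < ⋯ < b` is `t`. -/
inductive IsChainSum (K : Type*) [Field K] (m n b : ℕ) : ℕ → U K m n → K → Prop
  | base (t : K) : IsChainSum K m n b b (algebraMap K _ t) t
  | step (p : ℕ) (hp : p < b) (u : ℕ → U K m n) (t : ℕ → K)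
      (h : ∀ q ∈ Finset.Ioc p b, IsChainSum K m n b q (u q) (t q)) :
      IsChainSum K m n b p (∑ q ∈ Finset.Ioc p b, matUnit K m n q p * u q) (t (p + 1))

namespace IsChainSum

variable {b p : ℕ} {u u' : U K m n} {t t' : K}

theorem le (h : IsChainSum K m n b p u t) : p ≤ b := by
  cases h with
  | base => exact le_rfl
  | step _ hp => exact hp.le

theorem zero (hp : p ≤ b) : IsChainSum K m n b p 0 0 := by
  induction hd : b - p using Nat.strong_induction_on generalizing p with
  | _ d ih =>
    rcases hp.eq_or_lt with rfl | hlt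
    · simpa using base (K := K) (m := m) (n := n) (b := p) 0
    · have := step (K := K) (m := m) (n := n) p hlt (fun _ => 0) (fun _ => 0) fun q hq => by
        rw [Finset.mem_Ioc] at hq
        exact ih (b - q) (by omega) hq.2 rfl
      simpa using this

theorem add (h : IsChainSum K m n b p u t) (h' : IsChainSum K m n b p u' t') :
    IsChainSum K m n b p (u + u') (t + t') := by
  induction h generalizing u' t' with
  | base t =>
    cases h' with
    | base t' => rw [← map_add]; exact base _
    | step _ hp => exact absurd hp (lt_irrefl _)
  | step p hp u t h ih =>
    cases h' with
    | base => exact absurd hp (lt_irrefl _)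
    | step _ _ u' t' h' =>
      have := step (K := K) p hp (fun q => u q + u' q) (fun q => t q + t' q)
        fun q hq => ih q hq (h' q hq)
      simpa [mul_add, Finset.sum_add_distrib] using this

theorem smul (r : K) (h : IsChainSum K m n b p u t) : IsChainSum K m n b p (r • u) (r * t) := by
  induction h with
  | base t =>
    have := base (K := K) (m := m) (n := n) (b := b) (r * t)
    rwa [map_mul, ← Algebra.smul_def] at this
  | step p hp u t h ih =>
    have := step (K := K) p hp (fun q => r • u q) (fun q => r * t q) ih
    simpa [Finset.smul_sum] using this

theorem sum {ι : Type*} (s : Finset ι) (f : ι → U K m n) (g : ι → K) (hp : p ≤ b)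
    (h : ∀ i ∈ s, IsChainSum K m n b p (f i) (g i)) :
    IsChainSum K m n b p (∑ i ∈ s, f i) (∑ i ∈ s, g i) := by
  classical
  induction s using Finset.induction_on with
  | empty => simpa using zero hp
  | insert i s hi ih =>
    rw [Finset.sum_insert hi, Finset.sum_insert hi]
    exact (h i (Finset.mem_insert_self _ _)).add
      (ih fun j hj => h j (Finset.mem_insert_of_mem hj))

/-- Only the full chain from `p + 1` extends to the full chain from `p`. -/
theorem mul_left {q : ℕ} (hpq : p < q) (h : IsChainSum K m n b q u t) :
    IsChainSum K m n b p (matUnit K m n q p * u) (if q = p + 1 then t else 0) := by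
  have hqb := h.le
  have := step (K := K) (m := m) (n := n) p (hpq.trans_le hqb) (fun r => if r = q then u else 0)
    (fun r => if r = q then t else 0) fun r hr => by
      by_cases hrq : r = q
      · subst hrq; simpa using h
      · simpa [hrq] using zero (Finset.mem_Ioc.1 hr).2
  simp only [mul_ite, mul_zero, Finset.sum_ite_eq', Finset.mem_Ioc, hpq, hqb, and_self,
    if_true] at this
  simpa only [eq_comm (a := q)] using this

/-- The operators `e_{j,i}` of a chain from `p` have `p ≤ i < j`, so that `e_{k,l}` with `k < p` and
`l ≤ p` commutes with each of them. -/
theorem commute (hb : b < m + n) (h : IsChainSum K m n b p u t) {k l : ℕ} (hk : k < p)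
    (hl : l ≤ p) : Commute (matUnit K m n k l) u := by
  induction h with
  | base t => exact (Algebra.commutes t _).symm
  | step p hp u t h ih =>
    refine Commute.sum_right _ _ _ fun q hq => ?_
    rw [Finset.mem_Ioc] at hq
    refine Commute.mul_right ?_ (ih q (Finset.mem_Ioc.2 hq) (by omega) (by omega))
    exact matUnit_commute (by omega) (by omega) (by omega) (by omega) (by omega) (by omega)
      (by omega)

theorem sum_mul_lowering (hb : b < m + n) {q : ℕ} (hpq : p < q) {u : ℕ → U K m n} {t : ℕ → K}
    (h : ∀ r ∈ Finset.Ioc q b, IsChainSum K m n b r (u r) (t r)) :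
    (∑ r ∈ Finset.Ioc q b, matUnit K m n r q * u r) * matUnit K m n q p
      = matUnit K m n q p * (∑ r ∈ Finset.Ioc q b, matUnit K m n r q * u r)
        + ∑ r ∈ Finset.Ioc q b, matUnit K m n r p * u r := by
  rw [Finset.sum_mul, Finset.mul_sum, ← Finset.sum_add_distrib]
  refine Finset.sum_congr rfl fun r hr => ?_
  have hr' := Finset.mem_Ioc.1 hr
  rw [mul_assoc, ← ((h r hr).commute hb hr'.1 (by omega)).eq, ← mul_assoc,
    lowering_mul_lowering hpq hr'.1 (by omega), add_mul, mul_assoc]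

/-- Moving `e_{q,p}` to the left adds products over chains which skip `q`; these do not affect the
coefficient of the full chain. -/
theorem mul_right (hb : b < m + n) {q : ℕ} (hpq : p < q) (h : IsChainSum K m n b q u t) :
    IsChainSum K m n b p (u * matUnit K m n q p) (if q = p + 1 then t else 0) := by
  cases h with
  | base =>
    rw [Algebra.commutes]
    exact mul_left hpq (base t)
  | step _ hq u t h =>
    have h1 := mul_left hpq (step (K := K) q hq u t h)
    have h2 := step (K := K) (m := m) (n := n) p (hpq.trans hq) (fun r => if q < r then u r else 0)
      (fun r => if q < r then t r else 0) fun r hr => by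
        rw [Finset.mem_Ioc] at hr
        by_cases hqr : q < r
        · simpa [hqr] using h r (Finset.mem_Ioc.2 ⟨hqr, hr.2⟩)
        · simpa [hqr] using zero hr.2
    have h3 := h1.add h2
    rw [if_neg (show ¬ q < p + 1 by omega), add_zero] at h3
    convert h3 using 1
    have h4 : ∑ r ∈ Finset.Ioc p b, matUnit K m n r p * (if q < r then u r else 0)
        = ∑ r ∈ Finset.Ioc q b, matUnit K m n r p * u r := by
      simp only [mul_ite, mul_zero, ← Finset.sum_filter]
      refine Finset.sum_congr ?_ fun _ _ => rfl
      ext r; simp only [Finset.mem_filter, Finset.mem_Ioc]; omega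
    rw [h4, sum_mul_lowering hb hpq h]

theorem exists_step (hp : p < b) (h : IsChainSum K m n b p u t) :
    ∃ (v : ℕ → U K m n) (r : ℕ → K), (∀ q ∈ Finset.Ioc p b, IsChainSum K m n b q (v q) (r q))
      ∧ u = ∑ q ∈ Finset.Ioc p b, matUnit K m n q p * v q ∧ t = r (p + 1) := by
  cases h with
  | base => exact absurd hp (lt_irrefl _)
  | step _ _ v r h => exact ⟨v, r, h, rfl, rfl⟩

theorem exists_base (h : IsChainSum K m n b b u t) : u = algebraMap K _ t := by
  cases h with
  | base => rfl
  | step _ hp => exact absurd hp (lt_irrefl _)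

end IsChainSum

/-! ### Orderings of a chain -/

/-- The root `a = ε_i - ε_j` (in uniform notation) crosses `k` if `i ≤ k < j`. -/
def PosRoot.Crosses (k : ℕ) (a : PosRoot m n) : Prop := a.1.1.1 ≤ k ∧ k < a.1.2.1

instance (k : ℕ) : DecidablePred (PosRoot.Crosses (m := m) (n := n) k) :=
  fun _ => inferInstanceAs (Decidable (_ ∧ _))

theorem isOdd_iff_crosses (a : PosRoot m n) : a.IsOdd ↔ 0 < m ∧ a.Crosses (m - 1) := by
  rw [isOdd_iff]; unfold PosRoot.Crosses; omega

/-- The intervals `[i, j)` of the roots `(i, j)` of the list `w` tile the interval `[p, b)`: each point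
of it is covered once, and no other point is. -/
def Tiles (w : List (PosRoot m n)) (p b : ℕ) : Prop :=
  ∀ k, (w.countP fun a => a.Crosses k) = if p ≤ k ∧ k < b then 1 else 0

theorem Tiles.eq_nil {w : List (PosRoot m n)} {p b : ℕ} (h : Tiles w p b) (hpb : b ≤ p) :
    w = [] := by
  rw [List.eq_nil_iff_forall_not_mem]
  intro a ha
  have h1 := h a.1.1
  rw [if_neg (by omega), List.countP_eq_zero] at h1
  have h2 : a.1.1.1 < a.1.2.1 := a.2
  exact h1 a ha (by simpa [PosRoot.Crosses] using h2)

theorem Tiles.le_of_mem {w : List (PosRoot m n)} {p b : ℕ} (h : Tiles w p b) {a : PosRoot m n}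
    (ha : a ∈ w) : p ≤ a.1.1.1 ∧ a.1.2.1 ≤ b := by
  have h2 : a.1.1.1 < a.1.2.1 := a.2
  have key : ∀ k, a.Crosses k → p ≤ k ∧ k < b := by
    intro k hk
    have h1 := h k
    by_contra hc
    rw [if_neg hc, List.countP_eq_zero] at h1
    exact h1 a ha (by simpa using hk)
  have h3 := key a.1.1 ⟨le_rfl, h2⟩
  have h4 := key (a.1.2.1 - 1) ⟨by omega, by omega⟩
  omega

theorem Tiles.exists_first {w : List (PosRoot m n)} {p b : ℕ} (h : Tiles w p b) (hpb : p < b) :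
    ∃ w₁ s w₂, w = w₁ ++ s :: w₂ ∧ s.1.1.1 = p ∧ s.1.2.1 ≤ b ∧ Tiles (w₁ ++ w₂) s.1.2 b := by
  have h1 : 0 < w.countP (fun a => a.Crosses p) := by rw [h p, if_pos ⟨le_rfl, hpb⟩]; exact one_pos
  obtain ⟨s, hs, hsp⟩ := List.countP_pos_iff.1 h1
  have hsp' : s.Crosses p := by simpa using hsp
  obtain ⟨w₁, w₂, rfl⟩ := List.append_of_mem hs
  have h2 := h.le_of_mem hs
  have h3 : s.1.1.1 = p := le_antisymm hsp'.1 h2.1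
  refine ⟨w₁, s, w₂, rfl, h3, h2.2, fun k => ?_⟩
  have h4 := h k
  rw [List.countP_append, List.countP_cons] at h4
  rw [List.countP_append]
  have h5 : s.1.1.1 < s.1.2.1 := s.2
  have h6 : (if decide (s.Crosses k) = true then 1 else 0)
      = if s.1.1.1 ≤ k ∧ k < s.1.2.1 then 1 else 0 := by
    simp only [decide_eq_true_eq]; rfl
  rw [h6] at h4
  split_ifs at h4 ⊢ <;> omega

open Classical in
/-- The product of the lowering operators of a chain, taken in any order. -/
theorem Tiles.isChainSum {w : List (PosRoot m n)} {p b : ℕ} (h : Tiles w p b) (hpb : p ≤ b)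
    (hb : b < m + n) : IsChainSum K m n b p (w.map fun a => a.lowering K).prod
      (if ∀ a ∈ w, a.IsSimple then 1 else 0) := by
  induction hd : w.length using Nat.strong_induction_on generalizing w p with
  | _ d ih =>
    rcases hpb.eq_or_lt with rfl | hlt
    · rw [h.eq_nil le_rfl]
      simpa using IsChainSum.base (K := K) (m := m) (n := n) (b := p) 1
    obtain ⟨w₁, s, w₂, rfl, hs, hsb, hw⟩ := h.exists_first hlt
    have hlt' : s.1.1.1 < s.1.2.1 := s.2
    have hlen : (w₁ ++ w₂).length < d := by rw [← hd]; simp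
    have ih' := ih _ hlen hw hsb rfl
    have haug : (if ∀ a ∈ w₁ ++ s :: w₂, a.IsSimple then (1 : K) else 0)
        = if s.1.2.1 = p + 1 then (if ∀ a ∈ w₁ ++ w₂, a.IsSimple then 1 else 0) else 0 := by
      have : (∀ a ∈ w₁ ++ s :: w₂, a.IsSimple)
          ↔ s.1.2.1 = p + 1 ∧ ∀ a ∈ w₁ ++ w₂, a.IsSimple := by
        rw [← hs]
        simp only [List.mem_append, List.mem_cons]
        constructor
        · intro h
          exact ⟨h s (by simp), fun a ha => h a (by tauto)⟩
        · rintro ⟨h1, h2⟩ a (ha | rfl | ha)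
          · exact h2 a (by tauto)
          · exact h1
          · exact h2 a (by tauto)
      simp only [this, ite_and]
    rw [haug]
    have hcomm : ∀ a ∈ w₁ ++ w₂, a.1.1.1 ≠ s.1.2.1 → Commute (s.lowering K) (a.lowering K) := by
      intro a ha hne
      have h1 := hw.le_of_mem ha
      have h2 : a.1.1.1 < a.1.2.1 := a.2
      rw [lowering_eq, lowering_eq]
      exact matUnit_commute (by omega) (by omega) (by omega) (by omega) (by omega) (by omega)
        (by omega)
    have hprod : ∀ v : List (PosRoot m n), (∀ a ∈ v, Commute (s.lowering K) (a.lowering K)) →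
        Commute (s.lowering K) (v.map fun a => a.lowering K).prod := by
      intro v hv
      refine Commute.list_prod_right _ _ fun x hx => ?_
      obtain ⟨a, ha, rfl⟩ := List.mem_map.1 hx
      exact hv a ha
    -- At most one root of the chain starts where `s` ends, so that `s` can be moved to the left end or
    -- to the right end of the product.
    have hcases : (∀ a ∈ w₁, a.1.1.1 ≠ s.1.2.1) ∨ (∀ a ∈ w₂, a.1.1.1 ≠ s.1.2.1) := by
      by_contra hcon
      push Not at hcon
      obtain ⟨⟨a, ha, ha'⟩, ⟨c, hc, hc'⟩⟩ := hcon
      have h1 := hw s.1.2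
      rw [List.countP_append] at h1
      have h2 : 0 < w₁.countP (fun a => a.Crosses s.1.2.1) := List.countP_pos_iff.2
        ⟨a, ha, by have : a.1.1.1 < a.1.2.1 := a.2; simp [PosRoot.Crosses]; omega⟩
      have h3 : 0 < w₂.countP (fun a => a.Crosses s.1.2.1) := List.countP_pos_iff.2
        ⟨c, hc, by have : c.1.1.1 < c.1.2.1 := c.2; simp [PosRoot.Crosses]; omega⟩
      split_ifs at h1 <;> omega
    rw [List.map_append, List.prod_append] at ih'
    rw [List.map_append, List.map_cons, List.prod_append, List.prod_cons]
    rcases hcases with h1 | h1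
    · have h2 := hprod w₁ fun a ha => hcomm a (by simp [ha]) (h1 a ha)
      rw [← mul_assoc, ← h2.eq, mul_assoc, lowering_eq, hs]
      exact ih'.mul_left (by omega)
    · have h2 := hprod w₂ fun a ha => hcomm a (by simp [ha]) (h1 a ha)
      rw [h2.eq, ← mul_assoc, lowering_eq, hs]
      exact ih'.mul_right hb (by omega)

/-! ### Monomials of partitions -/

/-- The sum of the coordinates with index at most `k`. On a root it is `1` if the root crosses `k`, and
`0` otherwise. -/
def partialSum (k : ℕ) : Weight K m n →ₗ[K] K :=
  ∑ i : Fin (m + n) with i.1 ≤ k, LinearMap.proj i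

theorem partialSum_weight (k : ℕ) (a : PosRoot m n) :
    partialSum k (a.weight K) = if a.Crosses k then 1 else 0 := by
  have h : a.1.1.1 < a.1.2.1 := a.2
  unfold partialSum PosRoot.weight PosRoot.Crosses
  simp only [LinearMap.sum_apply, LinearMap.proj_apply, Pi.sub_apply, Finset.sum_sub_distrib,
    Pi.single_apply, Finset.sum_ite_eq', Finset.mem_filter, Finset.mem_univ, true_and]
  have h3 : k < a.1.2.1 ↔ ¬ a.1.2.1 ≤ k := by omega
  simp only [h3]
  by_cases h1 : a.1.1.1 ≤ k <;> by_cases h2 : a.1.2.1 ≤ k <;>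
    first | omega | simp [h1, h2]

/-- A list of roots with sum a root `c` is an ordering of a chain. -/
theorem tiles_of_sum_eq [CharZero K] (w : List (PosRoot m n)) (c : PosRoot m n)
    (h : (w.map fun a => a.weight K).sum = c.weight K) : Tiles w c.1.1 c.1.2 := by
  intro k
  have h1 := congrArg (partialSum k) h
  rw [partialSum_weight, map_list_sum, List.map_map] at h1
  have h2 : ∀ w : List (PosRoot m n), ((w.map (partialSum k ∘ fun a => a.weight K)).sum : K)
      = (w.countP fun a => a.Crosses k : ℕ) := by
    intro w
    induction w with
    | nil => simp
    | cons a w ih =>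
      rw [List.map_cons, List.sum_cons, ih, List.countP_cons, Function.comp_apply,
        partialSum_weight]
      push_cast
      rw [add_comm]
      simp
  rw [h2] at h1
  have h3 : ((if c.Crosses k then 1 else 0 : ℕ) : K) = if c.Crosses k then 1 else 0 := by
    split_ifs <;> simp
  rw [← h3] at h1
  exact Nat.cast_injective h1

open Classical in
/-- The monomial of a partition of a root is a sum over chains, in which the full chain has
coefficient `1` for the partition into simple roots, and `0` for all others. -/
theorem monomial_isChainSum [CharZero K] {L : List (PosRoot m n)} (hL : IsOrdering L)
    (c : PosRoot m n) {π : PosRoot m n → ℕ} (hπ : IsPartition K (c.weight K) π) :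
    IsChainSum K m n c.1.2 c.1.1 (monomial K L π)
      (if ∀ a, ¬ a.IsSimple → π a = 0 then 1 else 0) := by
  set w := L.flatMap fun a => List.replicate (π a) a with hw
  have hprod : monomial K L π = (w.map fun a => a.lowering K).prod := by
    unfold monomial
    rw [hw]
    clear hL hw
    clear w
    induction L with
    | nil => simp
    | cons a L ih => simp [ih, List.prod_replicate]
  have hsum : (w.map fun a => a.weight K).sum = c.weight K := by
    have h1 : (w.map fun a => a.weight K).sum = (L.map fun a => π a • a.weight K).sum := by
      rw [hw]
      clear hprod hw hL
      clear w
      induction L with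
      | nil => simp
      | cons a L ih => simp [ih, List.sum_replicate]
    rw [h1, ← hπ.2, ← List.sum_toFinset _ hL.1]
    congr 1
    ext a; simp [hL.2 a]
  have hcond : (∀ a, ¬ a.IsSimple → π a = 0) ↔ ∀ a ∈ w, a.IsSimple := by
    have : ∀ a, a ∈ w ↔ π a ≠ 0 := by
      intro a
      simp only [hw, List.mem_flatMap, List.mem_replicate]
      constructor
      · rintro ⟨x, _, h1, rfl⟩; exact h1
      · intro h; exact ⟨a, hL.2 a, h, rfl⟩
    refine forall_congr' fun a => ?_
    rw [this]; tauto
  have hlt : c.1.1.1 < c.1.2.1 := c.2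
  simp only [hcond]
  rw [hprod]
  exact (tiles_of_sum_eq w c hsum).isChainSum hlt.le c.1.2.2

/-- There is at most one partition of a given weight into simple roots. -/
theorem simple_partition_unique [CharZero K] {η : Weight K m n} {π π' : PosRoot m n → ℕ}
    (h : IsPartition K η π) (h' : IsPartition K η π') (hs : ∀ a, ¬ a.IsSimple → π a = 0)
    (hs' : ∀ a, ¬ a.IsSimple → π' a = 0) : π = π' := by
  funext a
  by_cases ha : a.IsSimple
  swap
  · rw [hs a ha, hs' a ha]
  have key : ∀ π : PosRoot m n → ℕ, IsPartition K η π → (∀ a, ¬ a.IsSimple → π a = 0) →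
      (π a : K) = partialSum a.1.1 η := by
    intro π hπ hs
    rw [← hπ.2, map_sum, Finset.sum_eq_single a]
    · have : a.1.1.1 < a.1.2.1 := a.2
      rw [map_nsmul, partialSum_weight, if_pos ⟨le_rfl, this⟩]; simp
    · intro c _ hca
      by_cases hc : c.IsSimple
      · rw [map_nsmul, partialSum_weight, if_neg, smul_zero]
        rintro ⟨h1, h2⟩
        have e1 : c.1.2.1 = c.1.1.1 + 1 := hc
        have e2 : a.1.2.1 = a.1.1.1 + 1 := ha
        exact hca (Subtype.ext (Prod.ext (Fin.ext (by omega)) (Fin.ext (by omega))))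
      · rw [hs c hc]; simp
    · simp
  exact Nat.cast_injective ((key π h hs).trans (key π' h' hs').symm)

end ChainSums

/-! ### Šapovalov elements on the highest weight vector -/

section Sapovalov

variable {K : Type*} [Field K] {m n : ℕ}

/-- `U(𝔥)` acts on the highest weight vector by scalars. -/
theorem exists_scalar_of_mem_Uh (l : Weight K m n) {h : U K m n} (hh : h ∈ Uh K m n) :
    ∃ r : K, h - algebraMap K _ r ∈ vermaIdeal K l := by
  induction hh using Algebra.adjoin_induction with
  | mem x hx =>
    obtain ⟨a, rfl⟩ := hx
    exact ⟨∑ i, l i * a i, Submodule.subset_span (Or.inr ⟨a, rfl⟩)⟩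
  | algebraMap r => exact ⟨r, by simp⟩
  | add x y _ _ hx hy =>
    obtain ⟨r, hr⟩ := hx
    obtain ⟨s, hs⟩ := hy
    refine ⟨r + s, ?_⟩
    rw [map_add, add_sub_add_comm]
    exact add_mem hr hs
  | mul x y _ _ hx hy =>
    obtain ⟨r, hr⟩ := hx
    obtain ⟨s, hs⟩ := hy
    refine ⟨r * s, ?_⟩
    have : x * y - algebraMap K _ (r * s)
        = x • (y - algebraMap K _ s) + (algebraMap K (U K m n) s) • (x - algebraMap K _ r) := by
      rw [smul_eq_mul, smul_eq_mul, mul_sub, mul_sub, ← Algebra.commutes s x, mul_comm r s, map_mul]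
      abel
    rw [this]
    exact add_mem (Submodule.smul_mem _ _ hs) (Submodule.smul_mem _ _ hr)

/-- On the highest weight vector, a Šapovalov element acts as a sum over chains in which the full chain
has coefficient `1`. -/
theorem IsSapovalov.exists_isChainSum [CharZero K] {L : List (PosRoot m n)} (hL : IsOrdering L)
    {c : PosRoot m n} {θ : U K m n} (h : IsSapovalov K L c θ) (l : Weight K m n) :
    ∃ z, IsChainSum K m n c.1.2 c.1.1 z 1 ∧ θ - z ∈ vermaIdeal K l := by
  classical
  obtain ⟨⟨H, hH1, hH2, ⟨π₀, hπ₀, hs₀, hH0⟩, rfl⟩, -⟩ := h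
  have hr : ∀ π, ∃ r : K, H π - algebraMap K _ r ∈ vermaIdeal K l ∧ (H π = 1 → r = 1) := by
    intro π
    by_cases hπ : H π = 1
    · exact ⟨1, by simp [hπ], fun _ => rfl⟩
    · obtain ⟨r, hr⟩ := exists_scalar_of_mem_Uh l (hH2 π)
      exact ⟨r, hr, fun h => absurd h hπ⟩
  choose r hr hr1 using hr
  have hlt : c.1.1.1 < c.1.2.1 := c.2
  refine ⟨∑ π ∈ H.support, r π • monomial K L π, ?_, ?_⟩
  · have h1 := IsChainSum.sum (b := c.1.2.1) (p := c.1.1.1) H.support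
      (fun π => r π • monomial K L π)
      (fun π => r π * if ∀ a, ¬ a.IsSimple → π a = 0 then 1 else 0) hlt.le fun π hπ =>
        (monomial_isChainSum hL c (hH1 π (Finsupp.mem_support_iff.1 hπ))).smul (r π)
    convert h1 using 1
    -- `H π₀ = 1` is an information only if `1 ≠ 0` in the enveloping algebra.
    have : Nontrivial (U K m n) := by
      refine ⟨1, 0, fun h10 => vacuum_ne_zero (K := K) (m := m) (n := n) ?_⟩
      have := congrArg (fun u => fockRep l u (vacuum K m n)) h10
      simpa using this
    rw [Finset.sum_eq_single π₀]
    · rw [if_pos hs₀, hr1 π₀ hH0, mul_one]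
    · intro π hπ hne
      rw [if_neg, mul_zero]
      exact fun hs => hne (simple_partition_unique (hH1 π (Finsupp.mem_support_iff.1 hπ)) hπ₀ hs hs₀)
    · intro hπ
      rw [Finsupp.notMem_support_iff, hH0] at hπ
      exact absurd hπ one_ne_zero
  · rw [Finsupp.sum, ← Finset.sum_sub_distrib]
    refine sum_mem fun π _ => ?_
    have : monomial K L π * H π - r π • monomial K L π
        = monomial K L π • (H π - algebraMap K _ (r π)) := by
      rw [smul_eq_mul, mul_sub, ← Algebra.commutes, Algebra.smul_def]
    rw [this]
    exact Submodule.smul_mem _ _ (hr π)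

/-- On the highest weight vector, a Šapovalov element of a root in `B l` yields a singular
vector. -/
theorem IsSapovalov.raising_mul_mem {L : List (PosRoot m n)} {l : Weight K m n} {c : PosRoot m n}
    (hc : c ∈ B K l) {θ : U K m n} (h : IsSapovalov K L c θ) (a : PosRoot m n) :
    a.raising K * θ ∈ vermaIdeal K l := by
  refine (sup_le ?_ ?_ : _ ≤ vermaIdeal K l) (h.2 a)
  · rw [Submodule.span_le, Set.singleton_subset_iff]
    have h0 : form K m n l (c.weight K) + form K m n (rho K) (c.weight K) = 0 := by
      rw [← hc.2]
      unfold form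
      rw [← Finset.sum_add_distrib]
      refine Finset.sum_congr rfl fun i _ => ?_
      rw [Pi.add_apply]; ring
    have h1 : form K m n l (c.weight K)
        = ∑ i, l i * ((if parity m n i = 0 then 1 else -1) * c.weight K i) := by
      unfold form
      exact Finset.sum_congr rfl fun i _ => by ring
    have h2 : hElt K m n (c.weight K)
        + algebraMap K (U K m n) (form K m n (rho K) (c.weight K))
        = toU K m n (Matrix.diagonal fun i =>
          (if parity m n i = 0 then 1 else -1) * c.weight K i)
          - algebraMap K (U K m n)
            (∑ i, l i * ((if parity m n i = 0 then 1 else -1) * c.weight K i)) := by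
      rw [← h1, eq_neg_of_add_eq_zero_left h0, map_neg, sub_neg_eq_add]; rfl
    rw [h2]
    exact Submodule.subset_span (Or.inr ⟨_, rfl⟩)
  · exact Submodule.span_mono Set.subset_union_left

end Sapovalov

/-! ### Chain sums on the vacuum -/

section ChainFock

variable {K : Type*} [Field K] {m n : ℕ}

theorem sum_Ioc_eq_add {M : Type*} [AddCommMonoid M] {p b : ℕ} (h : p < b) (f : ℕ → M) :
    ∑ q ∈ Finset.Ioc p b, f q = f (p + 1) + ∑ q ∈ Finset.Ioc (p + 1) b, f q := by
  have : Finset.Ioc p b = insert (p + 1) (Finset.Ioc (p + 1) b) := by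
    ext q; simp only [Finset.mem_insert, Finset.mem_Ioc]; omega
  rw [this, Finset.sum_insert (by simp)]

theorem neg_one_smul_U (x : U K m n) : (-1 : K) • x = -x := by
  rw [Algebra.smul_def, map_neg, map_one]
  exact neg_one_mul x

theorem q_commutator_smul {A : Type*} [Ring A] [Algebra K A] (f X : A) (s r : K) :
    f * (s • X) + r • ((s • X) * f - f * (s • X)) = s • ((1 - r) • (f * X) + r • (X * f)) := by
  simp only [mul_smul_comm, smul_mul_assoc]
  module

/-- Matrix units shift weights in every representation. -/
theorem diag_mul_matUnit (i : ℕ) (hi : i < m + n) {j k : ℕ} (hj : j < m + n) (hk : k < m + n) :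
    matUnit K m n i i * matUnit K m n j k = matUnit K m n j k * matUnit K m n i i
      + ((if i = j then 1 else 0) - (if i = k then 1 else 0) : K) • matUnit K m n j k := by
  have h := matUnit_mul (K := K) hi hi hj hk
  rw [unitSign_eq_one (by simp), one_smul, one_smul] at h
  rw [h, add_sub_assoc]
  congr 1
  by_cases h1 : i = j
  · subst h1
    by_cases h2 : i = k
    · subst h2; simp
    · simp [h2]
  · by_cases h2 : i = k
    · subst h2; simp [h1, neg_one_smul_U]
    · simp [h1, h2]

namespace IsChainSum

variable {b p : ℕ} {u : U K m n} {t : K}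

theorem mem_freshCopy (l : Weight K m n) (h : IsChainSum K m n b p u t) {k : ℕ} (hk : k < p) :
    fockRep l u (vacuum K m n) ∈ freshCopy k := by
  induction h with
  | base t =>
    rw [AlgHom.commutes, Module.algebraMap_end_apply]
    exact Submodule.smul_mem _ _ (vacuum_mem_freshCopy k)
  | step p hp u t h ih =>
    rw [map_sum, LinearMap.sum_apply]
    refine Submodule.sum_mem _ fun q hq => ?_
    have := (Finset.mem_Ioc.1 hq).1
    rw [map_mul, Module.End.mul_apply]
    by_cases hkp : k < p
    · exact fockRep_mem_freshCopy l hkp (ih q hq (by omega))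
    · omega

theorem raising_eq_zero (l : Weight K m n) (hb : b < m + n) (h : IsChainSum K m n b p u t) {i : ℕ}
    (hi : i + 1 ≤ p) :
    fockRep l (matUnit K m n i (i + 1)) (fockRep l u (vacuum K m n)) = 0 := by
  rw [← Module.End.mul_apply, ← map_mul, (h.commute hb (show i < p by omega) hi).eq, map_mul,
    Module.End.mul_apply, fockRep_raising l (Nat.lt_succ_self i), map_zero]

theorem diag_eq (l : Weight K m n) (hb : b < m + n) (h : IsChainSum K m n b p u t)
    (i : Fin (m + n)) :
    fockRep l (matUnit K m n i i) (fockRep l u (vacuum K m n))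
      = (l i - (if i.1 = p then 1 else 0) + (if i.1 = b then 1 else 0)) •
        fockRep l u (vacuum K m n) := by
  induction h with
  | base t =>
    rw [AlgHom.commutes, Module.algebraMap_end_apply, map_smul, fockRep_diag, smul_comm,
      sub_add_cancel]
  | step p hp u t h ih =>
    rw [map_sum, LinearMap.sum_apply, map_sum, Finset.smul_sum]
    refine Finset.sum_congr rfl fun q hq => ?_
    have hq' := Finset.mem_Ioc.1 hq
    rw [← Module.End.mul_apply, ← map_mul, ← mul_assoc, diag_mul_matUnit i.1 i.2 (by omega)
      (by omega), add_mul, map_add, LinearMap.add_apply, mul_assoc, map_mul, Module.End.mul_apply,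
      map_mul, Module.End.mul_apply, ih q hq, map_smul, smul_mul_assoc, map_smul,
      LinearMap.smul_apply, map_mul, Module.End.mul_apply, ← add_smul]
    congr 1
    ring

/-- A chain sum is determined by its action on the vacuum. -/
theorem eq_zero (l : Weight K m n) (hb : b < m + n) (h : IsChainSum K m n b p u t)
    (h0 : fockRep l u (vacuum K m n) = 0) : u = 0 ∧ t = 0 := by
  induction h with
  | base t =>
    rw [AlgHom.commutes, Module.algebraMap_end_apply, smul_eq_zero_iff_left vacuum_ne_zero] at h0
    simp [h0]
  | step p hp u t h ih =>
    rw [map_sum, LinearMap.sum_apply] at h0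
    simp only [map_mul, Module.End.mul_apply] at h0
    have h1 : ∀ q ∈ Finset.Ioc p b, u q = 0 ∧ t q = 0 := fun q hq =>
      ih q hq (eq_zero_of_sum_lowering l hb (fun q => fockRep l (u q) (vacuum K m n))
        (fun q hq => (h q hq).mem_freshCopy l (Finset.mem_Ioc.1 hq).1) h0 hq)
    refine ⟨Finset.sum_eq_zero fun q hq => ?_, (h1 (p + 1) (Finset.mem_Ioc.2 ⟨by omega, hp⟩)).2⟩
    rw [(h1 q hq).1, mul_zero]

end IsChainSum

/-- The nested `q`-commutators of the simple lowering operators `f_p = e_{p+1,p}`: the one of `d + 1`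
operators from `p` on is `(1 - c_{p+1}) f_p Θ + c_{p+1} Θ f_p`, for `Θ` the one of `d` operators from
`p + 1` on. The parameter `c_p` is not used at the starting index `p`. -/
def nestedComm (K : Type*) [Field K] (m n : ℕ) (c : ℕ → K) : ℕ → ℕ → U K m n
  | _, 0 => 1
  | p, d + 1 => (1 - c (p + 1)) • (matUnit K m n (p + 1) p * nestedComm K m n c (p + 1) d)
      + c (p + 1) • (nestedComm K m n c (p + 1) d * matUnit K m n (p + 1) p)

theorem nestedComm_succ (c : ℕ → K) (p d : ℕ) : nestedComm K m n c p (d + 1)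
    = (1 - c (p + 1)) • (matUnit K m n (p + 1) p * nestedComm K m n c (p + 1) d)
      + c (p + 1) • (nestedComm K m n c (p + 1) d * matUnit K m n (p + 1) p) := rfl

/-- The action of a simple raising operator `e_{p,p+1}` on a sum over chains from `p`. -/
theorem raising_first (l : Weight K m n) {b p : ℕ} (hb : b < m + n) (hp : p + 1 < b)
    {u : ℕ → U K m n} {t : ℕ → K}
    (h : ∀ q ∈ Finset.Ioc p b, IsChainSum K m n b q (u q) (t q)) :
    fockRep l (matUnit K m n p (p + 1))
      (fockRep l (∑ q ∈ Finset.Ioc p b, matUnit K m n q p * u q) (vacuum K m n))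
    = (l ⟨p, by omega⟩ - unitSign K m p (p + 1) p (p + 1) * (l ⟨p + 1, by omega⟩ - 1)) •
        fockRep l (u (p + 1)) (vacuum K m n)
      - unitSign K m p (p + 1) p (p + 1) • ∑ q ∈ Finset.Ioc (p + 1) b,
        fockRep l (matUnit K m n q (p + 1)) (fockRep l (u q) (vacuum K m n)) := by
  have hterm : ∀ q ∈ Finset.Ioc p b, fockRep l (matUnit K m n p (p + 1))
      (fockRep l (matUnit K m n q p * u q) (vacuum K m n))
      = (if p + 1 = q then fockRep l (matUnit K m n p p) (fockRep l (u q) (vacuum K m n)) else 0)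
        - unitSign K m p (p + 1) p (p + 1) •
          fockRep l (matUnit K m n q (p + 1)) (fockRep l (u q) (vacuum K m n)) := by
    intro q hq
    have hq' := Finset.mem_Ioc.1 hq
    have hs : unitSign K m p (p + 1) q p = unitSign K m p (p + 1) p (p + 1) := by
      unfold unitSign
      congr 1
      apply propext
      constructor <;> rintro ⟨h1, h2⟩ <;> exact ⟨by omega, by omega⟩
    rw [← Module.End.mul_apply, ← map_mul, ← mul_assoc, matUnit_mul (by omega) (by omega) (by omega)
      (by omega), if_pos rfl, hs, sub_mul, add_mul, map_sub, map_add, LinearMap.sub_apply,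
      LinearMap.add_apply, smul_mul_assoc, map_smul, LinearMap.smul_apply, mul_assoc, map_mul,
      Module.End.mul_apply, map_mul, Module.End.mul_apply,
      (h q hq).raising_eq_zero l hb (by omega), map_zero, smul_zero, zero_add, smul_mul_assoc,
      map_smul, LinearMap.smul_apply]
    congr 1
    · split_ifs <;> simp
    · rw [map_mul, Module.End.mul_apply]
  rw [map_sum, LinearMap.sum_apply, map_sum, Finset.sum_congr rfl hterm, Finset.sum_sub_distrib,
    ← Finset.smul_sum, sum_Ioc_eq_add (by omega : p < b) (fun q => fockRep l (matUnit K m n q (p + 1))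
      (fockRep l (u q) (vacuum K m n))), Finset.sum_ite_eq, if_pos (Finset.mem_Ioc.2
      ⟨by omega, by omega⟩)]
  have h1 := h (p + 1) (Finset.mem_Ioc.2 ⟨by omega, by omega⟩)
  have h2 := h1.diag_eq l hb ⟨p, by omega⟩
  have h3 := h1.diag_eq l hb ⟨p + 1, by omega⟩
  simp only [show ¬ p = p + 1 by omega, show ¬ p = b by omega, show ¬ p + 1 = b by omega, if_false,
    if_true, sub_zero, add_zero] at h2 h3
  rw [h2, h3, smul_add, smul_smul, sub_smul]
  abel

/-- The condition that a raising operator `e_{i,i+1}` with `p < i` kills a sum over chains from `p`,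
read off at the chains through `p + 1`. -/
theorem raising_later (l : Weight K m n) {b p i : ℕ} (hb : b < m + n) (hi : p < i) (hib : i + 1 < b)
    {u : ℕ → U K m n} {t : ℕ → K}
    (h : ∀ q ∈ Finset.Ioc p b, IsChainSum K m n b q (u q) (t q))
    (h0 : fockRep l (matUnit K m n i (i + 1))
      (fockRep l (∑ q ∈ Finset.Ioc p b, matUnit K m n q p * u q) (vacuum K m n)) = 0) :
    fockRep l (matUnit K m n i (i + 1)) (fockRep l (u (p + 1)) (vacuum K m n))
      + (if i = p + 1 then fockRep l (u (i + 1)) (vacuum K m n) else 0) = 0 := by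
  set ψ : ℕ → Fock K m n := fun q => unitSign K m i (i + 1) q p •
      fockRep l (matUnit K m n i (i + 1)) (fockRep l (u q) (vacuum K m n))
      + (if q = i then fockRep l (u (i + 1)) (vacuum K m n) else 0) with hψ
  have hterm : ∀ q ∈ Finset.Ioc p b, fockRep l (matUnit K m n i (i + 1))
      (fockRep l (matUnit K m n q p * u q) (vacuum K m n))
      = unitSign K m i (i + 1) q p • fockRep l (matUnit K m n q p)
          (fockRep l (matUnit K m n i (i + 1)) (fockRep l (u q) (vacuum K m n)))
        + (if i + 1 = q then fockRep l (matUnit K m n i p)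
          (fockRep l (u (i + 1)) (vacuum K m n)) else 0) := by
    intro q hq
    have hq' := Finset.mem_Ioc.1 hq
    rw [← Module.End.mul_apply, ← map_mul, ← mul_assoc, matUnit_mul (by omega) (by omega) (by omega)
      (by omega), if_neg (show i ≠ p by omega), smul_zero, sub_zero, add_mul, map_add,
      LinearMap.add_apply, smul_mul_assoc, map_smul, LinearMap.smul_apply, mul_assoc, map_mul,
      Module.End.mul_apply, map_mul, Module.End.mul_apply]
    congr 1
    split_ifs with hiq
    · rw [map_mul, Module.End.mul_apply, hiq]
    · simp
  have hsum : ∑ q ∈ Finset.Ioc p b, fockRep l (matUnit K m n q p) (ψ q) = 0 := by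
    rw [← h0, map_sum, LinearMap.sum_apply, map_sum, Finset.sum_congr rfl hterm,
      Finset.sum_add_distrib, Finset.sum_ite_eq, if_pos (Finset.mem_Ioc.2 ⟨by omega, by omega⟩)]
    simp only [hψ, map_add, map_smul, Finset.sum_add_distrib]
    congr 1
    rw [Finset.sum_eq_single i]
    · simp
    · intro q _ hq; simp [hq]
    · intro hq; exact absurd (Finset.mem_Ioc.2 ⟨hi, by omega⟩) hq
  have hmem : ∀ q ∈ Finset.Ioc p b, ψ q ∈ freshCopy p := by
    intro q hq
    have hq' := Finset.mem_Ioc.1 hq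
    refine Submodule.add_mem _ (Submodule.smul_mem _ _ (fockRep_mem_freshCopy l (by omega)
      ((h q hq).mem_freshCopy l hq'.1))) ?_
    split_ifs with hqi
    · exact (h (i + 1) (Finset.mem_Ioc.2 ⟨by omega, by omega⟩)).mem_freshCopy l (by omega)
    · exact zero_mem _
  have := eq_zero_of_sum_lowering l hb ψ hmem hsum (Finset.mem_Ioc.2 (⟨by omega, by omega⟩ :
    p < p + 1 ∧ p + 1 ≤ b))
  simp only [hψ] at this
  rw [unitSign_eq_one (by omega), one_smul] at this
  simpa only [eq_comm (a := p + 1)] using this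

/-- A sum over chains which is killed by the simple raising operators `e_{i,i+1}`, `p < i < b - 1`,
and on which `e_{p,p+1}` acts in a prescribed way, is a multiple of a nested commutator. -/
theorem chainSum_eq_nestedComm (l : Weight K m n) {b : ℕ} (hb : b < m + n) (c : ℕ → K)
    (hc : ∀ p, (hp : p + 1 < b) → c (p + 1) = unitSign K m p (p + 1) p (p + 1) *
      (l ⟨p, by omega⟩ - unitSign K m p (p + 1) p (p + 1) * (l ⟨p + 1, by omega⟩ - 1) + c p))
    (d p : ℕ) (hd : p + d + 1 = b) (u : ℕ → U K m n) (t : ℕ → K)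
    (h : ∀ q ∈ Finset.Ioc p b, IsChainSum K m n b q (u q) (t q))
    (h1 : p + 1 < b → fockRep l (matUnit K m n p (p + 1))
      (fockRep l (∑ q ∈ Finset.Ioc p b, matUnit K m n q p * u q) (vacuum K m n))
        + c p • fockRep l (u (p + 1)) (vacuum K m n) = 0)
    (h2 : ∀ i, p < i → i + 1 < b → fockRep l (matUnit K m n i (i + 1))
      (fockRep l (∑ q ∈ Finset.Ioc p b, matUnit K m n q p * u q) (vacuum K m n)) = 0) :
    ∑ q ∈ Finset.Ioc p b, matUnit K m n q p * u q = t (p + 1) • nestedComm K m n c p (d + 1) := by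
  induction d generalizing p u t with
  | zero =>
    obtain rfl : b = p + 1 := by omega
    have h3 := (h (p + 1) (by simp)).exists_base
    rw [sum_Ioc_eq_add (Nat.lt_succ_self p)]
    simp only [Finset.Ioc_self, Finset.sum_empty, add_zero, h3, nestedComm, mul_one, one_mul]
    rw [← add_smul, sub_add_cancel, one_smul, ← Algebra.commutes, ← Algebra.smul_def]
  | succ d ih =>
    have hp : p + 1 < b := by omega
    have hmem : p + 1 ∈ Finset.Ioc p b := Finset.mem_Ioc.2 ⟨by omega, by omega⟩
    obtain ⟨v, r, hv, huv, htr⟩ := (h (p + 1) hmem).exists_step hp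
    have hsub : ∀ q ∈ Finset.Ioc (p + 1) b, q ∈ Finset.Ioc p b := fun q hq => by
      rw [Finset.mem_Ioc] at hq ⊢; omega
    set τ := unitSign K m p (p + 1) p (p + 1) with hτ
    have hττ : τ * τ = 1 := by rw [hτ]; unfold unitSign; split_ifs <;> simp
    -- The condition on `e_{p,p+1}` determines the parts over the chains which skip `p + 1`.
    have hcoef : ∀ q ∈ Finset.Ioc (p + 1) b, u q = c (p + 1) • v q := by
      have e1 := h1 hp
      rw [raising_first l hb hp h, ← hτ] at e1
      have e2 : ∑ q ∈ Finset.Ioc (p + 1) b, fockRep l (matUnit K m n q (p + 1))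
          (fockRep l (u q) (vacuum K m n)) = c (p + 1) • fockRep l (u (p + 1)) (vacuum K m n) := by
        have e3 := congrArg (τ • ·) e1
        simp only [smul_add, smul_sub, smul_smul, hττ, one_smul, smul_zero] at e3
        rw [hc p hp, ← hτ]
        rw [mul_add, add_smul]
        rw [sub_add_eq_add_sub, sub_eq_zero] at e3
        exact e3.symm
      have e4 : ∑ q ∈ Finset.Ioc (p + 1) b, fockRep l (matUnit K m n q (p + 1))
          (fockRep l (u q + (-1 : K) • (c (p + 1) • v q)) (vacuum K m n)) = 0 := by
        simp only [map_add, map_smul, LinearMap.add_apply, LinearMap.smul_apply,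
          Finset.sum_add_distrib, e2, ← Finset.smul_sum]
        rw [huv, map_sum, LinearMap.sum_apply]
        simp only [map_mul, Module.End.mul_apply]
        module
      intro q hq
      have hch := (h q (hsub q hq)).add (((hv q hq).smul (c (p + 1))).smul (-1))
      have e5 := eq_zero_of_sum_lowering l hb
        (fun q => fockRep l (u q + (-1 : K) • (c (p + 1) • v q)) (vacuum K m n))
        (fun q hq => ((h q (hsub q hq)).add (((hv q hq).smul (c (p + 1))).smul (-1))).mem_freshCopy l
          (Finset.mem_Ioc.1 hq).1) e4 hq
      have e6 := (hch.eq_zero l hb e5).1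
      rw [neg_one_smul_U, ← sub_eq_add_neg, sub_eq_zero] at e6
      exact e6
    have hih := ih (p + 1) (by omega) v r hv
      (fun hp2 => by
        have e1 := raising_later l hb (Nat.lt_succ_self p) hp2 h (h2 _ (Nat.lt_succ_self p) hp2)
        rw [if_pos rfl, huv, hcoef (p + 1 + 1) (Finset.mem_Ioc.2 ⟨by omega, by omega⟩), map_smul,
          LinearMap.smul_apply] at e1
        exact e1)
      (fun i hi hib => by
        have e1 := raising_later l hb (by omega) hib h (h2 i (by omega) hib)
        rwa [if_neg (by omega), add_zero, huv] at e1)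
    rw [← huv, ← htr] at hih
    rw [sum_Ioc_eq_add (by omega), Finset.sum_congr rfl fun q hq => by rw [hcoef q hq]]
    have e1 := IsChainSum.sum_mul_lowering hb (Nat.lt_succ_self p) hv
    rw [← huv] at e1
    replace e1 := eq_sub_of_add_eq' e1.symm
    simp only [mul_smul_comm]
    rw [← Finset.smul_sum, e1, hih, nestedComm_succ]
    exact q_commutator_smul (K := K) (A := U K m n) _ _ _ _

/-- A sum over chains from `p` to `b` whose image on the vacuum is killed by the simple raising
operators `e_{i,i+1}`, `p ≤ i < b - 1`, is a multiple of a nested commutator. -/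
theorem IsChainSum.eq_nestedComm (l : Weight K m n) {b p : ℕ} (hb : b < m + n) (hp : p < b)
    (c : ℕ → K) (hcp : c p = 0)
    (hc : ∀ p, (hp : p + 1 < b) → c (p + 1) = unitSign K m p (p + 1) p (p + 1) *
      (l ⟨p, by omega⟩ - unitSign K m p (p + 1) p (p + 1) * (l ⟨p + 1, by omega⟩ - 1) + c p))
    {z : U K m n} {t : K} (h : IsChainSum K m n b p z t)
    (h0 : ∀ i, p ≤ i → i + 1 < b →
      fockRep l (matUnit K m n i (i + 1)) (fockRep l z (vacuum K m n)) = 0) :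
    z = t • nestedComm K m n c p (b - p) := by
  obtain ⟨u, r, hu, rfl, rfl⟩ := h.exists_step hp
  obtain ⟨d, hd⟩ : ∃ d, p + d + 1 = b := ⟨b - p - 1, by omega⟩
  rw [show b - p = d + 1 by omega]
  refine chainSum_eq_nestedComm l hb c hc d p hd u r hu (fun h => ?_) (fun i hi => h0 i hi.le)
  rw [h0 p le_rfl h, hcp, zero_smul, add_zero]

end ChainFock

/-! ### Factorizations of nested commutators -/

section Factor

variable {K : Type*} [Field K] {m n : ℕ}

theorem nestedComm_commute (c : ℕ → K) {d p k l : ℕ} (hb : p + d < m + n) (hk : k < p)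
    (hl : l ≤ p) : Commute (matUnit K m n k l) (nestedComm K m n c p d) := by
  induction d generalizing p with
  | zero => exact Commute.one_right _
  | succ d ih =>
    have h1 : Commute (matUnit K m n k l) (matUnit K m n (p + 1) p) :=
      matUnit_commute (by omega) (by omega) (by omega) (by omega) (by omega) (by omega) (by omega)
    have h2 := ih (p := p + 1) (by omega) (by omega) (by omega)
    rw [nestedComm_succ]
    exact ((h1.mul_right h2).smul_right _).add_right ((h2.mul_right h1).smul_right _)

/-- At an index `j` with `c_j = 0` the nested commutator has `Θ` from `j` on as a right factor, as the
earlier operators commute with it. -/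
theorem exists_nestedComm_eq_mul (c : ℕ → K) {d₁ d₂ p : ℕ} (hb : p + d₁ + d₂ + 1 < m + n)
    (hc : c (p + d₁ + 1) = 0) : ∃ A : U K m n,
      nestedComm K m n c p (d₂ + d₁ + 1) = A * nestedComm K m n c (p + d₁ + 1) d₂ := by
  induction d₁ generalizing p with
  | zero =>
    refine ⟨matUnit K m n (p + 1) p, ?_⟩
    simp only [add_zero] at hc ⊢
    rw [nestedComm_succ, hc, sub_zero, one_smul, zero_smul, add_zero]
  | succ d₁ ih =>
    obtain ⟨A, hA⟩ := ih (p := p + 1) (by omega) (by rw [← hc]; congr 1; omega)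
    rw [show p + 1 + d₁ + 1 = p + (d₁ + 1) + 1 by omega] at hA
    refine ⟨(1 - c (p + 1)) • (matUnit K m n (p + 1) p * A)
      + c (p + 1) • (A * matUnit K m n (p + 1) p), ?_⟩
    have h1 : Commute (matUnit K m n (p + 1) p) (nestedComm K m n c (p + (d₁ + 1) + 1) d₂) :=
      nestedComm_commute c (by omega) (by omega) (by omega)
    rw [nestedComm_succ, show d₂ + (d₁ + 1) = d₂ + d₁ + 1 by omega, hA, mul_assoc, ← h1.eq, add_mul,
      smul_mul_assoc, smul_mul_assoc, mul_assoc, mul_assoc]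

/-- At an index `j` with `c_j = 1` the nested commutator is the product of its parts after and before
`j`. -/
theorem nestedComm_eq_mul (c : ℕ → K) {d₁ d₂ p : ℕ} (hb : p + d₁ + d₂ + 1 < m + n)
    (hc : c (p + d₁ + 1) = 1) : nestedComm K m n c p (d₂ + d₁ + 1)
      = nestedComm K m n c (p + d₁ + 1) d₂ * nestedComm K m n c p (d₁ + 1) := by
  induction d₁ generalizing p with
  | zero =>
    simp only [add_zero] at hc ⊢
    rw [nestedComm_succ, nestedComm_succ, hc, sub_self, zero_smul, zero_smul, one_smul, one_smul,
      zero_add, zero_add, nestedComm, one_mul]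
  | succ d₁ ih =>
    have hA := ih (p := p + 1) (by omega) (by rw [← hc]; congr 1; omega)
    rw [show p + 1 + d₁ + 1 = p + (d₁ + 1) + 1 by omega] at hA
    have h1 : Commute (matUnit K m n (p + 1) p) (nestedComm K m n c (p + (d₁ + 1) + 1) d₂) :=
      nestedComm_commute c (by omega) (by omega) (by omega)
    rw [nestedComm_succ c p (d₂ + (d₁ + 1)), nestedComm_succ c p (d₁ + 1),
      show d₂ + (d₁ + 1) = d₂ + d₁ + 1 by omega, hA, ← mul_assoc, h1.eq, mul_add, mul_smul_comm,
      mul_smul_comm, mul_assoc, mul_assoc]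

end Factor

/-! ### An explicit formula for Šapovalov elements -/

section Formula

variable {K : Type*} [Field K] {m n : ℕ}

/-- The coefficients `c_j` of the nested commutator: `ξ - x_j` for even indices `j` and
`1 - ξ - x_j` for odd ones, where `x` are the coordinates of `l + ρ`. For the root `(a, b)`, the
parameter `ξ` is `x_a`. -/
def chainCoeff (l : Weight K m n) (ξ : K) (j : ℕ) : K :=
  if h : j < m + n then
    if j < m then ξ - (l + rho K : Weight K m n) ⟨j, h⟩
    else 1 - ξ - (l + rho K : Weight K m n) ⟨j, h⟩
  else 0

theorem chainCoeff_even (l : Weight K m n) (ξ : K) {j : Fin (m + n)} (h : j.1 < m) :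
    chainCoeff l ξ j = ξ - (l + rho K : Weight K m n) j := by
  simp [chainCoeff, h]

theorem chainCoeff_odd (l : Weight K m n) (ξ : K) {j : Fin (m + n)} (h : m ≤ j.1) :
    chainCoeff l ξ j = 1 - ξ - (l + rho K : Weight K m n) j := by
  simp [chainCoeff, h.not_gt]

/-- The recursion for the coefficients which the simple raising operators impose. -/
theorem chainCoeff_succ [CharZero K] (l : Weight K m n) (ξ : K) (p : ℕ) (hp : p + 1 < m + n) :
    chainCoeff l ξ (p + 1) = unitSign K m p (p + 1) p (p + 1) *
      (l ⟨p, by omega⟩ - unitSign K m p (p + 1) p (p + 1) * (l ⟨p + 1, hp⟩ - 1)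
        + chainCoeff l ξ p) := by
  set i : Fin (m + n) := ⟨p, by omega⟩ with hi
  set j : Fin (m + n) := ⟨p + 1, hp⟩ with hj
  change chainCoeff l ξ j = _ * (_ + chainCoeff l ξ i)
  by_cases h : p < m ↔ p + 1 < m
  · have hr := rho_sub_of_parity_eq (K := K) (i := i) (j := j) rfl h
    rw [unitSign_eq_one (Or.inl h), one_mul, one_mul]
    by_cases hpm : p < m
    · rw [chainCoeff_even l ξ (j := i) hpm, chainCoeff_even l ξ (j := j) (h.1 hpm), Pi.add_apply,
        Pi.add_apply]
      linear_combination hr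
    · rw [chainCoeff_odd l ξ (j := i) (not_lt.1 hpm),
        chainCoeff_odd l ξ (j := j) (not_lt.1 fun h' => hpm (h.2 h')), Pi.add_apply, Pi.add_apply]
      linear_combination hr
  · have hr := rho_add_of_parity_ne (K := K) (i := i) (j := j) rfl h
    have hs : unitSign K m p (p + 1) p (p + 1) = -1 := if_pos ⟨h, h⟩
    have h1 : p < m := by omega
    have h2 : m ≤ p + 1 := by omega
    rw [hs, chainCoeff_even l ξ (j := i) h1, chainCoeff_odd l ξ (j := j) h2, Pi.add_apply,
      Pi.add_apply]
    linear_combination -hr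

/-- The nested commutator attached to the root `c` and the highest weight `l`. -/
def sapovalovElt (l : Weight K m n) (c : PosRoot m n) : U K m n :=
  nestedComm K m n (chainCoeff l ((l + rho K : Weight K m n) c.1.1)) c.1.1 (c.1.2 - c.1.1)

/-- On the highest weight vector, every Šapovalov element agrees with the nested commutator, which is
therefore a sum over chains with coefficient `1` at the full chain. -/
theorem IsSapovalov.sub_mem [CharZero K] {L : List (PosRoot m n)} (hL : IsOrdering L)
    {l : Weight K m n} {c : PosRoot m n} (hc : c ∈ B K l) {θ : U K m n}
    (h : IsSapovalov K L c θ) :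
    θ - sapovalovElt l c ∈ vermaIdeal K l ∧
      IsChainSum K m n c.1.2 c.1.1 (sapovalovElt l c) 1 := by
  obtain ⟨z, hz, hθz⟩ := h.exists_isChainSum hL l
  have hlt : c.1.1.1 < c.1.2.1 := c.2
  have hcB := (mem_B_iff l c).1 hc
  have h1 := hz.eq_nestedComm l c.1.2.2 hlt
    (chainCoeff l ((l + rho K : Weight K m n) c.1.1))
    (by rw [chainCoeff_even l _ hcB.1.1, sub_self])
    (fun p hp => chainCoeff_succ l _ p (by have := c.1.2.2; omega))
    (fun i hi hib => by
      have hiN : i + 1 < m + n := by have := c.1.2.2; omega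
      have h2 := h.raising_mul_mem hc ⟨(⟨i, by omega⟩, ⟨i + 1, hiN⟩), Nat.lt_succ_self i⟩
      rw [raising_eq] at h2
      have h3 := (vermaIdeal K l).sub_mem h2 ((vermaIdeal K l).smul_mem
        (matUnit K m n i (i + 1)) hθz)
      rw [smul_eq_mul, mul_sub, sub_sub_cancel] at h3
      have h4 := fockRep_vermaIdeal l h3
      rwa [map_mul, Module.End.mul_apply] at h4)
  rw [one_smul] at h1
  change z = sapovalovElt l c at h1
  subst h1
  exact ⟨hθz, hz⟩

theorem smul_vermaVec_eq {l : Weight K m n} {u v : U K m n} (h : u - v ∈ vermaIdeal K l) :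
    u • vermaVec K l = v • vermaVec K l := by
  unfold vermaVec
  rw [← map_smul, ← map_smul, smul_eq_mul, smul_eq_mul, mul_one, mul_one, ← sub_eq_zero, ← map_sub]
  exact (Submodule.Quotient.mk_eq_zero _).2 h

end Formula

/-! ### The relation `c' ↓ c` -/

section Down

variable {K : Type*} [Field K] {m n : ℕ}

/-- All partial sums of a sum of positive roots are natural numbers, so every point crossed by `c'` is
crossed by `c`. -/
theorem BruhatLE.le [CharZero K] {c' c : PosRoot m n} (h : BruhatLE K c' c) :
    c.1.1 ≤ c'.1.1 ∧ c'.1.2 ≤ c.1.2 := by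
  have key : ∀ k, ∃ N : ℕ, partialSum k (c.weight K - c'.weight K) = N := by
    intro k
    unfold BruhatLE at h
    generalize c.weight K - c'.weight K = w at h
    induction h using AddSubmonoid.closure_induction with
    | mem x hx =>
      obtain ⟨a, _, rfl⟩ := hx
      rw [partialSum_weight]
      by_cases ha : a.Crosses k
      · exact ⟨1, by simp [ha]⟩
      · exact ⟨0, by simp [ha]⟩
    | zero => exact ⟨0, by simp⟩
    | add x y _ _ hx hy =>
      obtain ⟨N, hN⟩ := hx
      obtain ⟨N', hN'⟩ := hy
      exact ⟨N + N', by rw [map_add, hN, hN']; push_cast; rfl⟩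
  have hcross : ∀ k, c'.Crosses k → c.Crosses k := by
    intro k hk
    by_contra hck
    obtain ⟨N, hN⟩ := key k
    rw [map_sub, partialSum_weight, partialSum_weight, if_neg hck, if_pos hk, zero_sub] at hN
    have : ((N + 1 : ℕ) : K) = 0 := by push_cast; rw [← hN]; ring
    exact absurd (Nat.cast_eq_zero.1 this) (Nat.succ_ne_zero N)
  have hlt : c'.1.1.1 < c'.1.2.1 := c'.2
  have h1 := hcross c'.1.1 ⟨le_rfl, hlt⟩
  have h2 := hcross (c'.1.2.1 - 1) ⟨by omega, by omega⟩
  unfold PosRoot.Crosses at h1 h2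
  rw [Fin.le_def, Fin.le_def]
  omega

theorem form_weight_weight {c c' : PosRoot m n} (hc : c.IsOdd) (hc' : c'.IsOdd) :
    form K m n (c.weight K) (c'.weight K)
      = (if c'.1.1 = c.1.1 then 1 else 0) - (if c'.1.2 = c.1.2 then 1 else 0) := by
  rw [isOdd_iff] at hc hc'
  have h1 : c'.1.1 ≠ c.1.2 := fun h => by rw [h] at hc'; omega
  have h2 : c'.1.2 ≠ c.1.1 := fun h => by rw [h] at hc'; omega
  rw [form_weight, if_pos hc'.1, if_neg (by omega)]
  unfold PosRoot.weight
  simp only [Pi.sub_apply, Pi.single_apply, h1, h2, if_false]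
  ring

/-- For odd roots, `c' ↓ c` means that exactly one end of the interval of `c` is moved inwards. -/
theorem down_iff [CharZero K] {c' c : PosRoot m n} (hc' : c'.IsOdd) (hc : c.IsOdd) : Down K c' c ↔
    (c'.1.1 = c.1.1 ∧ c'.1.2 < c.1.2) ∨ (c'.1.2 = c.1.2 ∧ c.1.1 < c'.1.1) := by
  have ho := (isOdd_iff c).1 hc
  have ho' := (isOdd_iff c').1 hc'
  unfold Down
  rw [form_weight_weight hc hc']
  constructor
  · rintro ⟨hle, hne⟩
    have hle := hle.le
    by_cases h1 : c'.1.1 = c.1.1 <;> by_cases h2 : c'.1.2 = c.1.2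
    · simp [h1, h2] at hne
    · exact Or.inl ⟨h1, lt_of_le_of_ne hle.2 h2⟩
    · exact Or.inr ⟨h2, lt_of_le_of_ne hle.1 (Ne.symm h1)⟩
    · simp [h1, h2] at hne
  · rintro (⟨h1, h2⟩ | ⟨h1, h2⟩)
    · refine ⟨AddSubmonoid.subset_closure ⟨⟨(c'.1.2, c.1.2), h2⟩, ?_, ?_⟩, ?_⟩
      · rw [isOdd_iff]; dsimp only; omega
      · unfold PosRoot.weight; rw [h1]; abel
      · simp [h1, h2.ne]
    · refine ⟨AddSubmonoid.subset_closure ⟨⟨(c.1.1, c'.1.1), h2⟩, ?_, ?_⟩, ?_⟩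
      · rw [isOdd_iff]; dsimp only; omega
      · unfold PosRoot.weight; rw [h1]; abel
      · simp [h1, h2.ne']

end Down

/-! ### Roots which are not minimal -/

section NotMinimal

variable {K : Type*} [Field K] [CharZero K] {m n : ℕ}

/-- If `c' ↓ c` in `B l`, the nested commutator of `c` is a left multiple of the one
of `c'`. -/
theorem exists_sapovalovElt_eq_mul {l : Weight K m n} {c c' : PosRoot m n} (hc : c ∈ B K l)
    (hc' : c' ∈ B K l) (hd : Down K c' c) :
    ∃ A : U K m n, sapovalovElt l c = A * sapovalovElt l c' := by
  have h1 := (mem_B_iff l c).1 hc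
  have h2 := (mem_B_iff l c').1 hc'
  have hlt : c.1.1.1 < c.1.2.1 := c.2
  have hlt' : c'.1.1.1 < c'.1.2.1 := c'.2
  have hN := c.1.2.2
  rcases (down_iff hc'.1 hc.1).1 hd with ⟨e1, e2⟩ | ⟨e1, e2⟩
  · rw [Fin.lt_def] at e2
    refine ⟨nestedComm K m n (chainCoeff l ((l + rho K : Weight K m n) c.1.1)) c'.1.2
      (c.1.2 - c'.1.2), ?_⟩
    have h3 := nestedComm_eq_mul (m := m) (n := n)
      (chainCoeff l ((l + rho K : Weight K m n) c.1.1)) (d₁ := c'.1.2.1 - c'.1.1.1 - 1)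
      (d₂ := c.1.2.1 - c'.1.2.1) (p := c'.1.1.1) (by omega) (by
        rw [show c'.1.1.1 + (c'.1.2.1 - c'.1.1.1 - 1) + 1 = c'.1.2.1 by omega,
          chainCoeff_odd l _ h2.1.2, ← e1]
        linear_combination -h2.2)
    rw [show c'.1.1.1 + (c'.1.2.1 - c'.1.1.1 - 1) + 1 = c'.1.2.1 by omega,
      show c.1.2.1 - c'.1.2.1 + (c'.1.2.1 - c'.1.1.1 - 1) + 1 = c.1.2.1 - c'.1.1.1 by omega,
      show c'.1.2.1 - c'.1.1.1 - 1 + 1 = c'.1.2.1 - c'.1.1.1 by omega] at h3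
    unfold sapovalovElt
    rw [← e1] at h3 ⊢
    exact h3
  · rw [Fin.lt_def] at e2
    have hx : (l + rho K : Weight K m n) c.1.1 = (l + rho K : Weight K m n) c'.1.1 := by
      rw [e1] at h2
      linear_combination h1.2 - h2.2
    obtain ⟨A, hA⟩ := exists_nestedComm_eq_mul (m := m) (n := n)
      (chainCoeff l ((l + rho K : Weight K m n) c.1.1)) (d₁ := c'.1.1.1 - c.1.1.1 - 1)
      (d₂ := c.1.2.1 - c'.1.1.1) (p := c.1.1.1) (by rw [e1] at hlt'; omega) (by
        rw [show c.1.1.1 + (c'.1.1.1 - c.1.1.1 - 1) + 1 = c'.1.1.1 by omega,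
          chainCoeff_even l _ h2.1.1, hx, sub_self])
    rw [e1] at hlt'
    rw [show c.1.1.1 + (c'.1.1.1 - c.1.1.1 - 1) + 1 = c'.1.1.1 by omega,
      show c.1.2.1 - c'.1.1.1 + (c'.1.1.1 - c.1.1.1 - 1) + 1 = c.1.2.1 - c.1.1.1 by omega] at hA
    refine ⟨A, ?_⟩
    unfold sapovalovElt
    rw [hA, hx, e1]

/-- A root of `B l` which is not minimal is not independent. -/
theorem not_isIndependentAt {L : List (PosRoot m n)} (hL : IsOrdering L) {l : Weight K m n}
    {θ : PosRoot m n → U K m n} (hθ : ∀ c ∈ B K l, IsSapovalov K L c (θ c)) {c c' : PosRoot m n}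
    (hc : c ∈ B K l) (hc' : c' ∈ B K l) (hd : Down K c' c) (hne : c' ≠ c) :
    ¬ IsIndependentAt K θ l c := by
  obtain ⟨A, hA⟩ := exists_sapovalovElt_eq_mul hc hc' hd
  unfold IsIndependentAt
  rw [not_not, smul_vermaVec_eq ((hθ c hc).sub_mem hL hc).1, hA, mul_smul,
    ← smul_vermaVec_eq ((hθ c' hc').sub_mem hL hc').1]
  refine (le_iSup₂_of_le (f := fun c' (_ : c' ∈ B K l \ {c}) =>
    Submodule.span (U K m n) {θ c' • vermaVec K l}) c' ⟨hc', hne⟩ le_rfl) ?_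
  exact Submodule.smul_mem _ _ (Submodule.mem_span_singleton_self _)

end NotMinimal

/-! ### The quadratic Casimir element of `gl(m)` -/

section Casimir

variable {K : Type*} [Field K] {m n : ℕ}

variable (K m n) in
/-- The quadratic Casimir element `∑ e_{i,j} e_{j,i}` of the subalgebra `gl(m)`. -/
def casimir : U K m n :=
  ∑ i ∈ Finset.range m, ∑ j ∈ Finset.range m, matUnit K m n i j * matUnit K m n j i

/-- The Casimir element of `gl(m)` commutes with the even part of `gl(m,n)`. -/
theorem casimir_commute {k l : ℕ} (hk : k < m + n) (hl : l < m + n) (hkl : k < m ↔ l < m) :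
    Commute (casimir K m n) (matUnit K m n k l) := by
  have hcomm : ∀ i j, i < m → j < m → matUnit K m n i j * matUnit K m n k l
      = matUnit K m n k l * matUnit K m n i j + (if j = k then matUnit K m n i l else 0)
        - (if i = l then matUnit K m n k j else 0) := by
    intro i j hi hj
    have h := matUnit_mul (K := K) (m := m) (n := n) (i := i) (j := j) (by omega) (by omega) hk hl
    rwa [unitSign_eq_one (Or.inr hkl), one_smul, one_smul] at h
  have hterm : ∀ i ∈ Finset.range m, ∀ j ∈ Finset.range m,
      matUnit K m n i j * matUnit K m n j i * matUnit K m n k l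
      = matUnit K m n k l * (matUnit K m n i j * matUnit K m n j i)
        + ((if i = k then matUnit K m n i j * matUnit K m n j l else 0)
          - (if i = l then matUnit K m n k j * matUnit K m n j i else 0))
        + ((if j = k then matUnit K m n i l * matUnit K m n j i else 0)
          - (if j = l then matUnit K m n i j * matUnit K m n k i else 0)) := by
    intro i hi j hj
    rw [Finset.mem_range] at hi hj
    have h1 := hcomm i j hi hj
    have h2 := hcomm j i hj hi
    rw [mul_assoc, h2, mul_sub, mul_add, ← mul_assoc, h1, sub_mul, add_mul]
    simp only [mul_ite, ite_mul, mul_zero, zero_mul, mul_assoc]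
    abel
  unfold casimir Commute SemiconjBy
  rw [Finset.sum_mul, Finset.mul_sum]
  simp only [Finset.sum_mul, Finset.mul_sum]
  rw [Finset.sum_congr rfl fun i hi => Finset.sum_congr rfl (hterm i hi)]
  simp only [Finset.sum_add_distrib, Finset.sum_sub_distrib]
  rw [Finset.sum_comm (f := fun i j => if i = k then matUnit K m n i j * matUnit K m n j l else 0),
    Finset.sum_comm (f := fun i j => if i = l then matUnit K m n k j * matUnit K m n j i else 0)]
  simp only [Finset.sum_ite_eq', Finset.mem_range]
  by_cases hkm : k < m
  · simp only [hkm, hkl.1 hkm, if_true]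
    abel
  · have hlm : ¬ l < m := fun h => hkm (hkl.2 h)
    simp [hkm, hlm]

/-- The action of the Casimir element on a singular vector. -/
theorem casimir_singular (l : Weight K m n) {y : Fock K m n} (v : ℕ → K)
    (hr : ∀ i j : ℕ, i < j → j < m + n → fockRep l (matUnit K m n i j) y = 0)
    (hd : ∀ i : ℕ, i < m + n → fockRep l (matUnit K m n i i) y = v i • y) :
    fockRep l (casimir K m n) y = (∑ i ∈ Finset.range m, ∑ j ∈ Finset.range m,
      (if i = j then v i * v i else if i < j then v i - v j else 0)) • y := by
  unfold casimir
  simp only [map_sum, LinearMap.sum_apply, Finset.sum_smul]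
  refine Finset.sum_congr rfl fun i hi => Finset.sum_congr rfl fun j hj => ?_
  rw [Finset.mem_range] at hi hj
  rcases lt_trichotomy i j with h | h | h
  · rw [if_neg h.ne, if_pos h, matUnit_mul (by omega) (by omega) (by omega) (by omega), if_pos rfl,
      if_pos rfl, unitSign_eq_one (by omega), one_smul, one_smul, map_sub, map_add, map_mul,
      LinearMap.sub_apply, LinearMap.add_apply, Module.End.mul_apply, hr i j h (by omega), map_zero,
      zero_add, hd i (by omega), hd j (by omega), sub_smul]
  · subst h
    rw [if_pos rfl, map_mul, Module.End.mul_apply, hd i (by omega), map_smul, hd i (by omega),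
      smul_smul]
  · rw [if_neg h.ne', if_neg h.not_gt, map_mul, Module.End.mul_apply, hr j i h (by omega), map_zero,
      zero_smul]

/-- Subtracting `ε_r` from the weight `v` changes the eigenvalue of the Casimir element by
`2 r + 2 - m - 2 v_r`. -/
theorem casimir_value (v : ℕ → K) {r : ℕ} (hr : r < m) :
    (∑ i ∈ Finset.range m, ∑ j ∈ Finset.range m,
      (if i = j then (v i - if i = r then 1 else 0) * (v i - if i = r then 1 else 0)
        else if i < j then (v i - if i = r then 1 else 0) - (v j - if j = r then 1 else 0) else 0))
    = (∑ i ∈ Finset.range m, ∑ j ∈ Finset.range m,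
      (if i = j then v i * v i else if i < j then v i - v j else 0))
      + (2 * r + 2 - m - 2 * v r) := by
  have hterm : ∀ i j : ℕ,
      (if i = j then (v i - if i = r then 1 else 0) * (v i - if i = r then 1 else 0)
        else if i < j then (v i - if i = r then 1 else 0) - (v j - if j = r then 1 else 0) else 0)
      = (if i = j then v i * v i else if i < j then v i - v j else 0)
        + ((if i = j then (if i = r then 1 - 2 * v i else 0) else 0)
          + ((if j = r then (if i < j then 1 else 0) else 0)
            - (if i = r then (if i < j then 1 else 0) else 0))) := by
    intro i j
    rcases lt_trichotomy i j with h | h | h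
    · simp only [h, h.ne, if_true, if_false]; ring
    · subst h
      by_cases hir : i = r
      · simp only [hir, if_true, lt_self_iff_false, if_false]; ring
      · simp [hir]
    · simp [h.not_gt, h.ne']
  simp only [hterm, Finset.sum_add_distrib, Finset.sum_sub_distrib]
  congr 1
  have h1 : (∑ i ∈ Finset.range m, ∑ j ∈ Finset.range m,
      if i = j then (if i = r then 1 - 2 * v i else 0) else 0) = 1 - 2 * v r := by
    rw [Finset.sum_eq_single r]
    · simp [hr]
    · intro i _ hi; simp [hi]
    · intro h; exact absurd (Finset.mem_range.2 hr) h
  have h2 : (∑ i ∈ Finset.range m, ∑ j ∈ Finset.range m,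
      if j = r then (if i < j then (1 : K) else 0) else 0) = r := by
    simp only [Finset.sum_ite_eq', Finset.mem_range, hr, if_true, Finset.sum_boole]
    have : (Finset.range m).filter (fun i => i < r) = Finset.range r := by
      ext i; simp only [Finset.mem_filter, Finset.mem_range]; omega
    rw [this, Finset.card_range]
  have h3 : (∑ i ∈ Finset.range m, ∑ j ∈ Finset.range m,
      if i = r then (if i < j then (1 : K) else 0) else 0) = m - r - 1 := by
    rw [Finset.sum_comm]
    simp only [Finset.sum_ite_eq', Finset.mem_range, hr, if_true, Finset.sum_boole]
    have : (Finset.range m).filter (fun i => r < i) = Finset.Ioo r m := by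
      ext i; simp only [Finset.mem_filter, Finset.mem_range, Finset.mem_Ioo]; omega
    rw [this, Nat.card_Ioo, Nat.cast_sub (by omega), Nat.cast_sub (by omega), Nat.cast_one]
  rw [h1, h2, h3]
  ring

/-- On the even indices, `ρ` decreases by `1` in each step. -/
theorem rho_sub_rho [CharZero K] {i j : Fin (m + n)} (hi : i.1 < m) (hj : j.1 < m) :
    (rho K : Weight K m n) i - (rho K : Weight K m n) j = j.1 - i.1 := by
  have key : ∀ d (i : Fin (m + n)), i.1 + d < m → ∀ j : Fin (m + n), j.1 = i.1 + d →
      (rho K : Weight K m n) i - (rho K : Weight K m n) j = d := by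
    intro d
    induction d with
    | zero =>
      intro i _ j hj
      rw [Fin.ext (a := j) (b := i) (by omega)]; simp
    | succ d ih =>
      intro i hi j hj
      have h1 := ih i (by omega) ⟨i.1 + d, by omega⟩ rfl
      have h2 := rho_sub_of_parity_eq (K := K) (i := (⟨i.1 + d, by omega⟩ : Fin (m + n))) (j := j)
        (by simp only; omega) (by simp only; omega)
      push_cast
      linear_combination h1 + h2
  rcases le_total i.1 j.1 with h | h
  · have := key (j.1 - i.1) i (by omega) j (by omega)
    rwa [Nat.cast_sub h] at this
  · have := key (i.1 - j.1) j (by omega) i (by omega)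
    rw [Nat.cast_sub h] at this
    linear_combination -this

end Casimir

/-! ### Submodules generated by singular vectors -/

section Words

variable {K : Type*} [Field K] {m n : ℕ}

/-- The action of a product of lowering operators on the Fock space. -/
def lowerWord (l : Weight K m n) (w : List (PosRoot m n)) (y : Fock K m n) : Fock K m n :=
  fockRep l (w.map fun a => a.lowering K).prod y

theorem lowerWord_cons (l : Weight K m n) (a : PosRoot m n) (w : List (PosRoot m n))
    (y : Fock K m n) : lowerWord l (a :: w) y
      = fockRep l (matUnit K m n a.1.2 a.1.1) (lowerWord l w y) := by
  unfold lowerWord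
  rw [List.map_cons, List.prod_cons, map_mul, Module.End.mul_apply, lowering_eq]

/-- The span of the products of lowering operators applied to a singular weight vector is stable under
all matrix units. -/
theorem matUnit_lowerWord_mem (l : Weight K m n) {y : Fock K m n} (v : Fin (m + n) → K)
    (hr : ∀ i j : Fin (m + n), i < j → fockRep l (matUnit K m n i j) y = 0)
    (hd : ∀ i : Fin (m + n), fockRep l (matUnit K m n i i) y = v i • y)
    (w : List (PosRoot m n)) (i j : Fin (m + n)) :
    fockRep l (matUnit K m n i j) (lowerWord l w y)
      ∈ Submodule.span K (Set.range fun w => lowerWord l w y) := by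
  have hlow : ∀ (a : PosRoot m n), ∀ x ∈ Submodule.span K (Set.range fun w => lowerWord l w y),
      fockRep l (matUnit K m n a.1.2 a.1.1) x
        ∈ Submodule.span K (Set.range fun w => lowerWord l w y) := by
    intro a x hx
    have := Submodule.mem_map_of_mem (f := fockRep l (matUnit K m n a.1.2 a.1.1)) hx
    rw [Submodule.map_span] at this
    refine Submodule.span_mono ?_ this
    rintro _ ⟨_, ⟨w, rfl⟩, rfl⟩
    exact ⟨a :: w, lowerWord_cons l a w y⟩
  induction w generalizing i j with
  | nil =>
    have hnil : lowerWord l [] y = y := by simp [lowerWord]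
    have hy : y ∈ Submodule.span K (Set.range fun w => lowerWord l w y) :=
      Submodule.subset_span ⟨[], hnil⟩
    rw [hnil]
    rcases lt_trichotomy i j with h | h | h
    · rw [hr i j h]; exact zero_mem _
    · subst h; rw [hd]; exact Submodule.smul_mem _ _ hy
    · exact hlow ⟨(j, i), h⟩ y hy
  | cons a w ih =>
    rw [lowerWord_cons, ← Module.End.mul_apply, ← map_mul,
      matUnit_mul i.2 j.2 a.1.2.2 a.1.1.2, map_sub, map_add, LinearMap.sub_apply,
      LinearMap.add_apply, map_smul, LinearMap.smul_apply, map_mul, Module.End.mul_apply]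
    refine Submodule.sub_mem _ (Submodule.add_mem _ (Submodule.smul_mem _ _ (hlow a _ (ih i j))) ?_)
      ?_
    · split_ifs
      · exact ih i a.1.1
      · simp
    · rw [map_smul, LinearMap.smul_apply]
      refine Submodule.smul_mem _ _ ?_
      split_ifs
      · exact ih a.1.2 j
      · simp

theorem lowerWord_weight (l : Weight K m n) {y : Fock K m n} (v : Weight K m n)
    (hd : ∀ i : Fin (m + n), fockRep l (matUnit K m n i i) y = v i • y)
    (w : List (PosRoot m n)) (i : Fin (m + n)) :
    fockRep l (matUnit K m n i i) (lowerWord l w y)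
      = (v - (w.map fun a => a.weight K).sum) i • lowerWord l w y := by
  induction w with
  | nil => simpa [lowerWord] using hd i
  | cons a w ih =>
    rw [lowerWord_cons, ← Module.End.mul_apply, ← map_mul, diag_mul_matUnit _ i.2 a.1.2.2 a.1.1.2,
      map_add, LinearMap.add_apply, map_smul, LinearMap.smul_apply, map_mul, Module.End.mul_apply,
      ih, map_smul, ← add_smul]
    congr 1
    simp only [List.map_cons, List.sum_cons, Pi.sub_apply, Pi.add_apply, PosRoot.weight,
      Pi.single_apply, Fin.ext_iff]
    ring

/-- Products of even lowering operators preserve the eigenspaces of the Casimir element. -/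
theorem casimir_lowerWord (l : Weight K m n) {y : Fock K m n} {r : K}
    (hy : fockRep l (casimir K m n) y = r • y) {w : List (PosRoot m n)}
    (hw : ∀ a ∈ w, ¬ a.IsOdd) :
    fockRep l (casimir K m n) (lowerWord l w y) = r • lowerWord l w y := by
  induction w with
  | nil => simpa [lowerWord] using hy
  | cons a w ih =>
    have ha := hw a (by simp)
    rw [isOdd_iff] at ha
    have hlt : a.1.1.1 < a.1.2.1 := a.2
    rw [lowerWord_cons, ← Module.End.mul_apply, ← map_mul,
      (casimir_commute (K := K) a.1.2.2 a.1.1.2 (by omega)).eq, map_mul, Module.End.mul_apply,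
      ih fun a h => hw a (by simp [h]), map_smul]

end Words

/-! ### Minimal roots -/

section Minimal

variable {K : Type*} [Field K] [CharZero K] {m n : ℕ}

/-- A minimal root `c` and another root `c'` of `B l` inside of it start at indices where `l + ρ`
takes different values. -/
theorem IsMinimalAt.ne {l : Weight K m n} {c c' : PosRoot m n} (h : IsMinimalAt K l c)
    (hc : c ∈ B K l) (hc' : c' ∈ B K l) (hne : c' ≠ c) (h1 : c.1.1 ≤ c'.1.1)
    (h2 : c'.1.2 ≤ c.1.2) :
    (l + rho K : Weight K m n) c'.1.1 ≠ (l + rho K : Weight K m n) c.1.1 := by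
  intro hx
  have e1 := (mem_B_iff l c).1 hc
  have e2 := (mem_B_iff l c').1 hc'
  rcases h1.eq_or_lt with h3 | h3
  · refine hne (h c' hc' ((down_iff hc'.1 hc.1).2 (Or.inl ⟨h3.symm, lt_of_le_of_ne h2 fun h4 => ?_⟩)))
    exact hne (Subtype.ext (Prod.ext h3.symm h4))
  · have hlt : c'.1.1 < c.1.2 := by rw [Fin.lt_def]; omega
    have hB : (⟨(c'.1.1, c.1.2), hlt⟩ : PosRoot m n) ∈ B K l := by
      rw [mem_B_iff]
      refine ⟨⟨e2.1.1, e1.1.2⟩, ?_⟩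
      dsimp only
      rw [hx, e1.2]
    have := h _ hB ((down_iff hB.1 hc.1).2 (Or.inr ⟨rfl, h3⟩))
    rw [← this] at h3
    exact lt_irrefl _ h3

/-- A minimal root of `B l` is independent. -/
theorem isIndependentAt_of_isMinimalAt {L : List (PosRoot m n)} (hL : IsOrdering L)
    {l : Weight K m n} {θ : PosRoot m n → U K m n}
    (hθ : ∀ c ∈ B K l, IsSapovalov K L c (θ c)) {c : PosRoot m n} (hc : c ∈ B K l)
    (hmin : IsMinimalAt K l c) : IsIndependentAt K θ l c := by
  intro hmem
  -- The images of the singular vectors in the Fock space.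
  set y : PosRoot m n → Fock K m n := fun c => fockRep l (θ c) (vacuum K m n) with hy
  have hyθ : ∀ c ∈ B K l, y c = fockRep l (sapovalovElt l c) (vacuum K m n) := by
    intro c hc
    have := fockRep_vermaIdeal l ((hθ c hc).sub_mem hL hc).1
    rwa [map_sub, LinearMap.sub_apply, sub_eq_zero] at this
  have hraise : ∀ c ∈ B K l, ∀ i j : Fin (m + n), i < j →
      fockRep l (matUnit K m n i j) (y c) = 0 := by
    intro c hc i j hij
    have := fockRep_vermaIdeal l ((hθ c hc).raising_mul_mem hc ⟨(i, j), hij⟩)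
    rwa [raising_eq, map_mul, Module.End.mul_apply] at this
  have hdiag : ∀ c ∈ B K l, ∀ i : Fin (m + n),
      fockRep l (matUnit K m n i i) (y c) = (l - c.weight K) i • y c := by
    intro c hc i
    rw [hyθ c hc, ((hθ c hc).sub_mem hL hc).2.diag_eq l c.1.2.2 i]
    congr 1
    simp only [Pi.sub_apply, PosRoot.weight, Pi.single_apply, Fin.ext_iff]
    ring
  -- The products of lowering operators applied to the other singular vectors; their span is stable
  -- under the enveloping algebra.
  set X : Set (Fock K m n) := {x | ∃ c' ∈ B K l \ {c}, ∃ w, x = lowerWord l w (y c')} with hX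
  have hstable : ∀ (u : U K m n), ∀ x ∈ Submodule.span K X, fockRep l u x ∈ Submodule.span K X := by
    intro u
    induction u using U_induction with
    | hc r =>
      intro x hx
      rw [AlgHom.commutes, Module.algebraMap_end_apply]
      exact Submodule.smul_mem _ _ hx
    | he i j =>
      intro x hx
      have := Submodule.mem_map_of_mem (f := fockRep l (matUnit K m n i j)) hx
      rw [Submodule.map_span] at this
      refine Submodule.span_le.2 ?_ this
      rintro _ ⟨_, ⟨c', hc', w, rfl⟩, rfl⟩
      refine Submodule.span_mono ?_ (matUnit_lowerWord_mem l _ (hraise c' hc'.1) (hdiag c' hc'.1)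
        w i j)
      rintro _ ⟨w, rfl⟩
      exact ⟨c', hc', w, rfl⟩
    | hadd a b ha hb =>
      intro x hx
      rw [map_add, LinearMap.add_apply]
      exact Submodule.add_mem _ (ha x hx) (hb x hx)
    | hmul a b ha hb =>
      intro x hx
      rw [map_mul, Module.End.mul_apply]
      exact ha _ (hb x hx)
  let J : Submodule (U K m n) (U K m n) :=
    { carrier := {u | fockRep l u (vacuum K m n) ∈ Submodule.span K X}
      zero_mem' := by simp
      add_mem' := fun {a b} ha hb => by
        change fockRep l (a + b) (vacuum K m n) ∈ Submodule.span K X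
        rw [map_add, LinearMap.add_apply]
        exact Submodule.add_mem _ ha hb
      smul_mem' := fun a b hb => by
        change fockRep l (a * b) (vacuum K m n) ∈ Submodule.span K X
        rw [map_mul, Module.End.mul_apply]
        exact hstable a _ hb }
  have hyX : y c ∈ Submodule.span K X := by
    have hsup : (⨆ c' ∈ B K l \ {c}, Submodule.span (U K m n) {θ c' • vermaVec K l})
        ≤ J.map (vermaIdeal K l).mkQ := by
      refine iSup₂_le fun c' hc' => ?_
      rw [Submodule.span_singleton_le_iff_mem]
      refine ⟨θ c', Submodule.subset_span ⟨c', hc', [], ?_⟩, ?_⟩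
      · simp [lowerWord, hy]
      · unfold vermaVec
        rw [← map_smul, smul_eq_mul, mul_one]
    obtain ⟨u, huJ, hu⟩ := hsup hmem
    have huJ' : fockRep l u (vacuum K m n) ∈ Submodule.span K X := huJ
    unfold vermaVec at hu
    rw [← map_smul, smul_eq_mul, mul_one, ← sub_eq_zero, ← map_sub] at hu
    have h1 := fockRep_vermaIdeal l ((Submodule.Quotient.mk_eq_zero _).1 hu)
    rw [map_sub, LinearMap.sub_apply, sub_eq_zero] at h1
    change fockRep l (θ c) (vacuum K m n) ∈ Submodule.span K X
    rwa [← h1]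
  -- Only the products of weight `l - c` contribute.
  have hunit : ∀ i : Fin (m + n), fockRep l (matUnit K m n i i) = fockUnit (fockParam l) i i :=
    fun i => fockHom_matUnit _ i i
  have hyw := mem_span_of_weight (fockParam l) X (by
    rintro _ ⟨c', hc', w, rfl⟩
    exact ⟨_, fun i => by rw [← hunit]; exact lowerWord_weight l _ (hdiag c' hc'.1) w i⟩)
    (l - c.weight K) (fun i => by rw [← hunit]; exact hdiag c hc i) hyX
  -- The eigenvalue of the Casimir element on `y c`. The extension of `l` by `0` beyond the indices below
  -- `m + n` does not matter: only indices below `m` occur.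
  set κ : PosRoot m n → K := fun c => (∑ i ∈ Finset.range m, ∑ j ∈ Finset.range m,
      (if i = j then (if h : i < m + n then l ⟨i, h⟩ else 0) * (if h : i < m + n then l ⟨i, h⟩ else 0)
        else if i < j then (if h : i < m + n then l ⟨i, h⟩ else 0)
          - (if h : j < m + n then l ⟨j, h⟩ else 0) else 0))
      + (2 * (c.1.1.1 : K) + 2 - m - 2 * l c.1.1) with hκ
  have hcas : ∀ c ∈ B K l, fockRep l (casimir K m n) (y c) = κ c • y c := by
    intro c hc
    have h1 := ((mem_B_iff l c).1 hc).1
    rw [casimir_singular l (fun i => (if h : i < m + n then l ⟨i, h⟩ else 0)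
        - (if i = c.1.1.1 then 1 else 0) + (if i = c.1.2.1 then 1 else 0))
      (fun i j hij hj => hraise c hc ⟨i, by omega⟩ ⟨j, hj⟩ hij) (fun i hi => by
        have := hdiag c hc ⟨i, hi⟩
        rw [this]
        congr 1
        simp only [Pi.sub_apply, PosRoot.weight, Pi.single_apply, Fin.ext_iff, hi, dif_pos]
        ring)]
    congr 1
    have h2 := casimir_value (m := m) (fun i => if h : i < m + n then l ⟨i, h⟩ else 0) h1.1
    simp only [hκ]
    simp only [show c.1.1.1 < m + n from c.1.1.2, dif_pos] at h2
    rw [← h2]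
    refine Finset.sum_congr rfl fun i hi => Finset.sum_congr rfl fun j hj => ?_
    rw [Finset.mem_range] at hi hj
    rw [if_neg (show ¬ i = c.1.2.1 by omega), if_neg (show ¬ j = c.1.2.1 by omega), add_zero,
      add_zero]
  have hyE : y c ∈ ⨆ (r : K) (_ : r ≠ κ c), (fockRep l (casimir K m n)).eigenspace r := by
    refine Submodule.span_le.2 ?_ hyw
    rintro _ ⟨⟨c', hc', w, rfl⟩, hwt⟩
    by_cases h0 : lowerWord l w (y c') = 0
    · rw [h0]; exact zero_mem _
    -- By weights, `c'` and `w` form a chain for `c`.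
    have hsum : ((c' :: w).map fun a => a.weight K).sum = c.weight K := by
      funext i
      have h1 := hwt i
      rw [← hunit, lowerWord_weight l _ (hdiag c' hc'.1) w i] at h1
      have h2 := smul_left_injective K h0 h1
      simp only [Pi.sub_apply] at h2
      rw [List.map_cons, List.sum_cons, Pi.add_apply]
      linear_combination -h2
    have htile := tiles_of_sum_eq _ c hsum
    have hle := htile.le_of_mem (List.mem_cons_self (a := c') (l := w))
    have ho' := (isOdd_iff_crosses c').1 hc'.1.1
    -- A chain has a single odd root, the one which crosses `m - 1`.
    have heven : ∀ a ∈ w, ¬ a.IsOdd := by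
      intro a ha hodd
      have h1 := htile (m - 1)
      rw [List.countP_cons, if_pos (by simpa using ho'.2)] at h1
      have h2 : 0 < w.countP fun a => a.Crosses (m - 1) := List.countP_pos_iff.2
        ⟨a, ha, by simpa using ((isOdd_iff_crosses a).1 hodd).2⟩
      split_ifs at h1
      omega
    have hne := hmin.ne hc hc'.1 hc'.2 hle.1 hle.2
    have hκne : κ c' ≠ κ c := by
      intro h
      have hρ := rho_sub_rho (K := K) (((mem_B_iff l c').1 hc'.1).1.1)
        (((mem_B_iff l c).1 hc).1.1)
      simp only [hκ] at h
      refine hne ?_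
      rw [Pi.add_apply, Pi.add_apply]
      have h2 : (2 : K) ≠ 0 := two_ne_zero
      refine mul_left_cancel₀ h2 ?_
      linear_combination -h + 2 * hρ
    refine (le_iSup₂_of_le (f := fun (r : K) (_ : r ≠ κ c) =>
      (fockRep l (casimir K m n)).eigenspace r) (κ c') hκne le_rfl) ?_
    rw [Module.End.mem_eigenspace_iff]
    exact casimir_lowerWord l (hcas c' hc'.1) heven
  have hzero : y c = 0 := by
    have hdis := Module.End.eigenspaces_iSupIndep (fockRep l (casimir K m n)) (κ c)
    exact Submodule.disjoint_def.1 hdis _ (Module.End.mem_eigenspace_iff.2 (hcas c hc)) hyE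
  rw [hyθ c hc] at hzero
  exact one_ne_zero (((hθ c hc).sub_mem hL hc).2.eq_zero l c.1.2.2 hzero).2

end Minimal

end

end GLSuper

theorem theorem9p3 (K : Type*) [Field K] [IsAlgClosed K] [CharZero K] (m n : ℕ)
    (L : List (GLSuper.PosRoot m n)) (hL : GLSuper.IsOrdering L)
    (l : GLSuper.Weight K m n)
    (θ : GLSuper.PosRoot m n → GLSuper.U K m n)
    (hθ : ∀ c ∈ GLSuper.B K l, GLSuper.IsSapovalov K L c (θ c))
    (c : GLSuper.PosRoot m n) (hc : c ∈ GLSuper.B K l) :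
    GLSuper.IsIndependentAt K θ l c ↔ GLSuper.IsMinimalAt K l c := by
  refine ⟨fun h c' hc' hd => ?_, GLSuper.isIndependentAt_of_isMinimalAt hL hθ hc⟩
  by_contra hne
  exact GLSuper.not_isIndependentAt hL hθ hc hc' hd hne h
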